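/- Let $(\mathcal M,g)$ be a smooth $n$-dimensional pseudo-Riemannian manifold (of any signature; in particular Lorentzian), with Levi-Civita connection $D$ and wave operator $\square_g=g^{\alpha\beta}D_\alpha D_\beta$. Let $O\subset\mathcal M$ be open, $p\in\partial O$, and let $h$ be a smooth defining function of $O$ on an open neighbourhood $U_1$ of $p$: $h<0$ on $O\cap U_1$, $h=0$ on $\partial O\cap U_1$, $dh(p)\neq0$. Let $U_1$ lie in the domain of a coordinate chart $(x^\alpha)$ of $\mathcal M$; all components are taken, and all lengths $|Y|^2=\sum_\alpha (Y^\alpha)^2$, $|D\phi|^2=\sum_\alpha(\partial_\alpha\phi)^2$, $|D^2\phi|^2=\sum_{\alpha,\beta}(D_\alpha D_\beta\phi)^2$ are measured, in this chart, and $L^2$ is taken with respect to the volume measure $|\det(g_{\alpha\beta})|^{1/2}dx$ of $g$. Assume that $h$ satisfies the quantitative strict null-convexity condition in $U_1$: there are constants $M>0$ and $\mu\in[-M,M]$ such that, at every point of $U_1$ and for every vector $Y=Y^\alpha\partial_\alpha$, $$|dh|\ge M^{-1},\qquad Y^\alpha Y^\beta\left(\mu g_{\alpha\beta}-D_\alpha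 D_\beta h\right)+M|Y(h)|^2\ge M^{-1}|Y|^2 .$$ Let $V\subset U_1$ be compact. Then there is $\varepsilon_0>0$ such that for every $\varepsilon\in(0,\varepsilon_0)$ there are constants $C_\varepsilon>0$ and $\lambda_\varepsilon>0$ with the following property. Let $U_\varepsilon\subset V$ be an open neighbourhood of $p$ on which $|h|\le\frac12\varepsilon$, let $e_\varepsilon$ be a $C^2$ function on $U_\varepsilon$ with $\sup_{U_\varepsilon}|D^je_\varepsilon|\le\varepsilon^2$ for $j=0,1,2$, and put $f_\varepsilon=\log(\varepsilon+h+e_\varepsilon)$. Then, for all $\phi\in C^2_0(U_\varepsilon)$ (real-valued $C^2$ functions with compact support in $U_\varepsilon$) and all $\lambda\ge\lambda_\varepsilon$, $$\lambda\,\|e^{-\lambda f_\varepsilon}\phi\|_{L^2}+\|e^{-\lambda f_\varepsilon}D\phi\|_{L^2}\le C_\varepsilon\,\lambda^{-1/2}\,\|e^{-\lambda f_\varepsilon}\square_g\phi\|_{L^2}.$$ -/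

import Mathlib

open scoped Manifold ContDiff
open MeasureTheory

/-- The coordinate space `ℝⁿ`, with its Euclidean norm and Lebesgue measure. -/
abbrev Coord (n : ℕ) : Type := EuclideanSpace ℝ (Fin n)

/-- The `i`-th coordinate vector field `∂ᵢ` of the chart `c`, at the point with coordinates `y`. -/
noncomputable def coordFrame {n : ℕ} {M : Type*} [TopologicalSpace M] [ChartedSpace (Coord n) M]
    (c : OpenPartialHomeomorph M (Coord n)) (y : Coord n) (i : Fin n) :
    TangentSpace 𝓘(ℝ, Coord n) (c.symm y) :=
  mfderiv 𝓘(ℝ, Coord n) 𝓘(ℝ, Coord n) c.symm y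
    (EuclideanSpace.single i (1 : ℝ) : Coord n)

/-- A smooth pseudo-Riemannian metric (of any signature) on an `n`-dimensional manifold: a symmetric
nondegenerate bilinear form on each tangent space whose components are smooth in every chart of the
smooth structure. -/
structure PseudoRiemannianMetric (n : ℕ) (M : Type*) [TopologicalSpace M]
    [ChartedSpace (Coord n) M] where
  form : ∀ x : M, TangentSpace 𝓘(ℝ, Coord n) x →ₗ[ℝ] TangentSpace 𝓘(ℝ, Coord n) x →ₗ[ℝ] ℝ
  symmetric : ∀ x v w, form x v w = form x w v
  nondegenerate : ∀ x v, (∀ w, form x v w = 0) → v = 0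
  smooth : ∀ c ∈ IsManifold.maximalAtlas 𝓘(ℝ, Coord n) ∞ M, ∀ i j : Fin n,
    ContDiffOn ℝ ∞ (fun y => form (c.symm y) (coordFrame c y i) (coordFrame c y j)) c.target

/-- The partial derivative `∂ᵢ u` of a function of the coordinates. -/
noncomputable def partialD {n : ℕ} (i : Fin n) (u : Coord n → ℝ) (y : Coord n) : ℝ :=
  fderiv ℝ u y (EuclideanSpace.single i (1 : ℝ))

/-- The coordinate length `|Du| = (∑ᵢ (∂ᵢ u)²)^{1/2}` of the differential of `u`. -/
noncomputable def diffNorm {n : ℕ} (u : Coord n → ℝ) (y : Coord n) : ℝ :=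
  Real.sqrt (∑ i, partialD i u y ^ 2)

namespace PseudoRiemannianMetric

variable {n : ℕ} {M : Type*} [TopologicalSpace M] [ChartedSpace (Coord n) M]

/-- The matrix `(g_{ij})` of the metric in the chart `c`. -/
noncomputable def gram (g : PseudoRiemannianMetric n M) (c : OpenPartialHomeomorph M (Coord n))
    (y : Coord n) : Matrix (Fin n) (Fin n) ℝ :=
  Matrix.of fun i j => g.form (c.symm y) (coordFrame c y i) (coordFrame c y j)

/-- The Christoffel symbols
`Γᵏᵢⱼ = ½ ∑ₗ gᵏˡ (∂ᵢ gⱼₗ + ∂ⱼ gᵢₗ - ∂ₗ gᵢⱼ)` of the Levi-Civita connection in the chart `c`. -/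
noncomputable def christoffel (g : PseudoRiemannianMetric n M)
    (c : OpenPartialHomeomorph M (Coord n)) (k i j : Fin n) (y : Coord n) : ℝ :=
  (1 / 2 : ℝ) * ∑ l, (g.gram c y)⁻¹ k l *
    (partialD i (fun z => g.gram c z j l) y + partialD j (fun z => g.gram c z i l) y
      - partialD l (fun z => g.gram c z i j) y)

/-- The components `Dᵢ Dⱼ u = ∂ᵢ ∂ⱼ u - ∑ₖ Γᵏᵢⱼ ∂ₖ u` of the covariant Hessian in the chart `c`;
`u` is a function of the coordinates. -/
noncomputable def hess (g : PseudoRiemannianMetric n M) (c : OpenPartialHomeomorph M (Coord n))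
    (u : Coord n → ℝ) (i j : Fin n) (y : Coord n) : ℝ :=
  partialD i (partialD j u) y - ∑ k, g.christoffel c k i j y * partialD k u y

/-- The coordinate length `|D²u| = (∑ᵢⱼ (DᵢDⱼu)²)^{1/2}` of the covariant Hessian. -/
noncomputable def hessNorm (g : PseudoRiemannianMetric n M)
    (c : OpenPartialHomeomorph M (Coord n)) (u : Coord n → ℝ) (y : Coord n) : ℝ :=
  Real.sqrt (∑ i, ∑ j, g.hess c u i j y ^ 2)

/-- The wave operator `□_g u = ∑ᵢⱼ gⁱʲ Dᵢ Dⱼ u` in the chart `c`. -/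
noncomputable def box (g : PseudoRiemannianMetric n M) (c : OpenPartialHomeomorph M (Coord n))
    (u : Coord n → ℝ) (y : Coord n) : ℝ :=
  ∑ i, ∑ j, (g.gram c y)⁻¹ i j * g.hess c u i j y

/-- The volume measure `|det (g_{ij})|^{1/2} dy` of the metric on the image of the chart `c`. -/
noncomputable def chartVolume (g : PseudoRiemannianMetric n M)
    (c : OpenPartialHomeomorph M (Coord n)) : Measure (Coord n) :=
  (volume.restrict c.target).withDensity
    fun y => ENNReal.ofReal (Real.sqrt |(g.gram c y).det|)

/-- The quantitative strict null-convexity condition for `h` on `U`, in the coordinates of the chart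
`c` and with constants `K` and `μ`:
`|dh| ≥ K⁻¹` and `Yᵃ Yᵇ (μ g_{ab} - D_a D_b h) + K |Y(h)|² ≥ K⁻¹ |Y|²` for every vector `Y = Yᵃ ∂_a`
at every point of `U`, where `|Y|² = ∑ₐ (Yᵃ)²`. -/
structure StrictNullConvexOn (g : PseudoRiemannianMetric n M)
    (c : OpenPartialHomeomorph M (Coord n)) (h : M → ℝ) (U : Set M) (K μ : ℝ) : Prop where
  pos : 0 < K
  mem_Icc : μ ∈ Set.Icc (-K) K
  le_diffNorm : ∀ x ∈ U, K⁻¹ ≤ diffNorm (h ∘ c.symm) (c x)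
  convex : ∀ x ∈ U, ∀ Y : Fin n → ℝ,
    K⁻¹ * ∑ a, Y a ^ 2 ≤
      (∑ a, ∑ b, Y a * Y b * (μ * g.gram c (c x) a b - g.hess c (h ∘ c.symm) a b (c x)))
        + K * (∑ a, Y a * partialD a (h ∘ c.symm) (c x)) ^ 2

/-- `e` is a negligible perturbation at scale `ε` on `U`: it is `C²` on `U` and
`|e|`, `|De|`, `|D²e|` are at most `ε²` there. -/
structure IsNegligible (g : PseudoRiemannianMetric n M)
    (c : OpenPartialHomeomorph M (Coord n)) (U : Set M) (ε : ℝ) (e : M → ℝ) : Prop where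
  contMDiffOn : ContMDiffOn 𝓘(ℝ, Coord n) 𝓘(ℝ) 2 e U
  abs_le : ∀ x ∈ U, |e x| ≤ ε ^ 2
  diffNorm_le : ∀ x ∈ U, diffNorm (e ∘ c.symm) (c x) ≤ ε ^ 2
  hessNorm_le : ∀ x ∈ U, g.hessNorm c (e ∘ c.symm) (c x) ≤ ε ^ 2

end PseudoRiemannianMetric

/-- `h` is a smooth defining function of the open set `O` on the open neighbourhood `U` of the
boundary point `p`, nondegenerate at `p`. -/
structure IsDefiningFunction {n : ℕ} {M : Type*} [TopologicalSpace M] [ChartedSpace (Coord n) M]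
    (O : Set M) (p : M) (U : Set M) (h : M → ℝ) : Prop where
  isOpen_domain : IsOpen O
  mem_frontier : p ∈ frontier O
  isOpen_nhd : IsOpen U
  mem_nhd : p ∈ U
  smooth : ContMDiffOn 𝓘(ℝ, Coord n) 𝓘(ℝ) ∞ h U
  neg : ∀ x ∈ O ∩ U, h x < 0
  eq_zero : ∀ x ∈ frontier O ∩ U, h x = 0
  nondegenerate : mfderiv 𝓘(ℝ, Coord n) 𝓘(ℝ) h p ≠ 0

/-- The weight `f_ε = log (ε + h + e)`. -/
noncomputable def carlemanWeight {M : Type*} (ε : ℝ) (h e : M → ℝ) (x : M) : ℝ :=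
  Real.log (ε + h x + e x)

/-! The proof is a positive commutator (energy) argument for the conjugated function ψ = e^{-λf}φ.
Conjugation turns `e^{-λf} □φ` into Tψ + λ(□f)ψ with Tψ = □ψ + 2λ⟨df,dψ⟩ + λ²⟨df,df⟩ψ
(`box_exp_mul`). Multiplying Tψ by ⟨df,dψ⟩ + wψ and integrating by parts
(`integral_multiplier_identity`) leaves, besides the good term 2λ⟨df,dψ⟩² and terms with w of lower
order in λ, the quadratic form −D²f(∇ψ,∇ψ) + (½□f − w)⟨dψ,dψ⟩ and the coefficient −D²f(∇f,∇f) − (½□f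
− w)⟨df,df⟩ of λ²ψ². The metric is indefinite, so both must be made positive by the choice of f and
w.

Write s = 1/(ε+h+e). Then −D²f = −s D²(h+e) + s² d(h+e)⊗d(h+e), and w is chosen so that ½□f − w =
s(μ + ½□e). The quadratic form is thus s(μg − D²h) plus the large square s²|Y(h+e)|², up to errors
controlled by e. Since s is at least 1/(2ε), the square dominates the term K|Y(h)|² of the convexity
condition, and the form is at least (2K)⁻¹ s|Y|² + ½s²|Y(h+e)|² (`IsPerturbation.coercive`).

The coefficient of λ²ψ² comes from the same inequality at Y = ∇f. The sign in front of ½□f − w is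
now the opposite one, which costs 2(½□f − w)⟨df,df⟩. The square in the lower bound is now ½⟨df,df⟩²
and reduces this cost to O(s²), while |∇f|² is comparable to s² because dh ≠ 0, so the first term
grows like s³ and wins for small ε (`IsPerturbation.transversal`).

For large λ the remaining terms are absorbed pointwise (`carleman_pointwise_bound`). All constants
are uniform in the neighbourhood and in e, since only derivatives of e up to order two occur
(`exists_weight_bound`). -/

/-! ### Calculus of coordinate partial derivatives -/

section PartialDerivatives

variable {n : ℕ} {W : Set (Coord n)} {u v : Coord n → ℝ} {y : Coord n}

theorem ContDiffOn.partialD {k m : WithTop ℕ∞} (hu : ContDiffOn ℝ m u W) (hW : IsOpen W)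
    (hkm : k + 1 ≤ m) (i : Fin n) : ContDiffOn ℝ k (partialD i u) W :=
  (hu.fderiv_of_isOpen hW hkm).clm_apply contDiffOn_const

theorem Filter.EventuallyEq.partialD_eq (h : u =ᶠ[nhds y] v) (i : Fin n) :
    partialD i u y = partialD i v y := by
  simp only [partialD, h.fderiv_eq]

theorem Filter.EventuallyEq.partialD (h : u =ᶠ[nhds y] v) (i : Fin n) :
    partialD i u =ᶠ[nhds y] partialD i v :=
  h.eventuallyEq_nhds.mono fun _ hz => hz.partialD_eq i

theorem partialD_const (a : ℝ) (i : Fin n) : partialD i (fun _ => a) y = 0 := by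
  simp [partialD]

theorem partialD_add (hu : DifferentiableAt ℝ u y) (hv : DifferentiableAt ℝ v y) (i : Fin n) :
    partialD i (fun z => u z + v z) y = partialD i u y + partialD i v y := by
  simp only [partialD]
  rw [fderiv_fun_add hu hv]; simp

theorem partialD_sub (hu : DifferentiableAt ℝ u y) (hv : DifferentiableAt ℝ v y) (i : Fin n) :
    partialD i (fun z => u z - v z) y = partialD i u y - partialD i v y := by
  simp only [partialD]
  rw [fderiv_fun_sub hu hv]; simp

theorem partialD_mul (hu : DifferentiableAt ℝ u y) (hv : DifferentiableAt ℝ v y) (i : Fin n) :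
    partialD i (fun z => u z * v z) y = partialD i u y * v y + u y * partialD i v y := by
  simp only [partialD]
  rw [fderiv_fun_mul hu hv]; simp; ring

theorem partialD_const_mul (hu : DifferentiableAt ℝ u y) (a : ℝ) (i : Fin n) :
    partialD i (fun z => a * u z) y = a * partialD i u y := by
  rw [partialD_mul (differentiableAt_const a) hu, partialD_const]; ring

theorem partialD_sum {ι : Type*} (s : Finset ι) {F : ι → Coord n → ℝ}
    (hF : ∀ k ∈ s, DifferentiableAt ℝ (F k) y) (i : Fin n) :
    partialD i (fun z => ∑ k ∈ s, F k z) y = ∑ k ∈ s, partialD i (F k) y := by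
  simp only [partialD]
  rw [fderiv_fun_sum hF]; simp

theorem partialD_comp {F : ℝ → ℝ} {F' : ℝ} (hF : HasDerivAt F F' (u y))
    (hu : DifferentiableAt ℝ u y) (i : Fin n) :
    partialD i (fun z => F (u z)) y = F' * partialD i u y := by
  have := (hF.comp_hasFDerivAt y hu.hasFDerivAt).fderiv
  simp only [partialD]
  rw [show (fun z => F (u z)) = F ∘ u from rfl, this]
  simp

theorem partialD_comm (hu : ContDiffAt ℝ 2 u y) (i j : Fin n) :
    partialD i (partialD j u) y = partialD j (partialD i u) y := by
  have h1 : DifferentiableAt ℝ (fderiv ℝ u) y :=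
    (hu.fderiv_right (m := 1) (by norm_num)).differentiableAt (by norm_num)
  have h2 := (hu.isSymmSndFDerivAt (by simp)) (EuclideanSpace.single i (1 : ℝ))
    (EuclideanSpace.single j (1 : ℝ))
  have h3 : ∀ k l : Fin n, partialD k (partialD l u) y =
      fderiv ℝ (fderiv ℝ u) y (EuclideanSpace.single k (1 : ℝ))
        (EuclideanSpace.single l (1 : ℝ)) := by
    intro k l
    change fderiv ℝ (fun z => fderiv ℝ u z (EuclideanSpace.single l (1 : ℝ))) y _ = _
    rw [fderiv_clm_apply h1 (differentiableAt_const _)]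
    simp
  rw [h3, h3, h2]

theorem ContDiffOn.differentiableAt_of_isOpen {m : WithTop ℕ∞} (hu : ContDiffOn ℝ m u W)
    (hW : IsOpen W) (hy : y ∈ W) (hm : m ≠ 0) : DifferentiableAt ℝ u y :=
  (hu.contDiffAt (hW.mem_nhds hy)).differentiableAt hm

end PartialDerivatives

/-! ### Jacobi's formula and smoothness of determinant and inverse -/

/-- Factoring out A reduces to det(1 + tB) with B = A⁻¹A', whose linear coefficient in t is the
trace of B. -/
theorem Matrix.hasDerivAt_det_add_smul {m : Type*} [Fintype m] [DecidableEq m]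
    {A A' : Matrix m m ℝ} (hA : IsUnit A.det) :
    HasDerivAt (fun t : ℝ => (A + t • A').det) (A.det * (A⁻¹ * A').trace) 0 := by
  obtain ⟨q, hq⟩ : ∃ q : Polynomial ℝ, ∀ t : ℝ,
      (1 + t • (A⁻¹ * A')).det = 1 + (A⁻¹ * A').trace * t + q.eval t * t ^ 2 :=
    ⟨_, fun t => Matrix.det_one_add_smul t _⟩
  have h1 : (fun t : ℝ => (A + t • A').det) = fun t : ℝ => A.det *
      (1 + (A⁻¹ * A').trace * t + q.eval t * t ^ 2) := by
    funext t
    rw [← hq, ← Matrix.det_mul, mul_add, mul_one, Matrix.mul_smul,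
      Matrix.mul_nonsing_inv_cancel_left _ _ hA]
  rw [h1]
  have h2 := ((((hasDerivAt_id (0 : ℝ)).const_mul (A⁻¹ * A').trace).const_add 1).add
    ((q.hasDerivAt 0).mul (hasDerivAt_pow 2 (0 : ℝ)))).const_mul A.det
  exact h2.congr_deriv (by simp)

theorem partialD_det {n : ℕ} {m : Type*} [Fintype m] [DecidableEq m]
    {A : Coord n → Matrix m m ℝ} {y : Coord n}
    (hA : ∀ a b, DifferentiableAt ℝ (fun z => A z a b) y) (hdet : IsUnit (A y).det) (i : Fin n) :
    partialD i (fun z => (A z).det) y =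
      (A y).det * ∑ a, ∑ b, (A y)⁻¹ a b * partialD i (fun z => A z b a) y := by
  let F : (m → m → ℝ) → ℝ := fun B => Matrix.det (Matrix.of B)
  let G : Coord n → m → m → ℝ := fun z a b => A z a b
  let A' : m → m → ℝ := fun a b => partialD i (fun z => A z a b) y
  have hF : Differentiable ℝ F := by
    simp only [F, Matrix.det_apply, Matrix.of_apply]
    fun_prop
  have hG : HasFDerivAt G (ContinuousLinearMap.pi fun a => ContinuousLinearMap.pi fun b =>
      fderiv ℝ (fun z => A z a b) y) y :=
    hasFDerivAt_pi.2 fun a => hasFDerivAt_pi.2 fun b => (hA a b).hasFDerivAt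
  have h1 : partialD i (fun z => (A z).det) y = fderiv ℝ F (G y) A' := by
    have := ((hF (G y)).hasFDerivAt.comp y hG).fderiv
    simp only [partialD]
    rw [show (fun z => (A z).det) = F ∘ G from rfl, this]
    rfl
  -- The determinant is polynomial in the entries, so its differential is determined by derivatives
  -- along lines, which the previous lemma computes.
  have h2 : HasDerivAt (fun t : ℝ => F (G y + t • A')) (fderiv ℝ F (G y) A') 0 := by
    have h3 : HasDerivAt (fun t : ℝ => G y + t • A') A' 0 := by
      simpa using ((hasDerivAt_id (0 : ℝ)).smul_const A').const_add (G y)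
    have h4 : HasFDerivAt F (fderiv ℝ F (G y)) (G y + (0 : ℝ) • A') := by
      simpa using (hF (G y)).hasFDerivAt
    exact h4.comp_hasDerivAt (0 : ℝ) h3
  rw [h1, h2.unique (Matrix.hasDerivAt_det_add_smul (A' := Matrix.of A') hdet)]
  simp [Matrix.trace, Matrix.mul_apply, A', Matrix.diag]
  rfl

theorem ContDiffOn.matrix_det {E m : Type*} [NormedAddCommGroup E] [NormedSpace ℝ E] [Fintype m]
    [DecidableEq m] {k : WithTop ℕ∞} {A : E → Matrix m m ℝ} {W : Set E}
    (hA : ∀ a b, ContDiffOn ℝ k (fun z => A z a b) W) :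
    ContDiffOn ℝ k (fun z => (A z).det) W := by
  simp only [Matrix.det_apply]
  exact ContDiffOn.sum fun σ _ => (contDiffOn_prod fun i _ => hA _ _).const_smul _

theorem ContDiffOn.matrix_inv {E m : Type*} [NormedAddCommGroup E] [NormedSpace ℝ E] [Fintype m]
    [DecidableEq m] {k : WithTop ℕ∞} {A : E → Matrix m m ℝ} {W : Set E}
    (hA : ∀ a b, ContDiffOn ℝ k (fun z => A z a b) W) (hdet : ∀ z ∈ W, (A z).det ≠ 0) (a b : m) :
    ContDiffOn ℝ k (fun z => (A z)⁻¹ a b) W := by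
  have h1 : ContDiffOn ℝ k (fun z => ((A z).det)⁻¹ * (A z).adjugate a b) W := by
    refine ((ContDiffOn.matrix_det hA).inv hdet).mul ?_
    simp only [Matrix.adjugate_apply]
    refine ContDiffOn.matrix_det fun i j => ?_
    by_cases hi : i = b
    · subst hi
      simp only [Matrix.updateRow_self]
      exact contDiffOn_const
    · simp only [Matrix.updateRow_ne hi]
      exact hA i j
  refine h1.congr fun z _ => ?_
  simp [Matrix.inv_def]

/-! ### Levi-Civita calculus in a chart -/

namespace PseudoRiemannianMetric

variable {n : ℕ} {M : Type*} [TopologicalSpace M] [ChartedSpace (Coord n) M]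
  {g : PseudoRiemannianMetric n M} {c : OpenPartialHomeomorph M (Coord n)}
  {u v : Coord n → ℝ} {W : Set (Coord n)} {y : Coord n}

theorem gram_symm (y : Coord n) (i j : Fin n) : g.gram c y i j = g.gram c y j i :=
  g.symmetric _ _ _

theorem gram_inv_symm (y : Coord n) (i j : Fin n) : (g.gram c y)⁻¹ i j = (g.gram c y)⁻¹ j i := by
  have h : (g.gram c y).transpose = g.gram c y := by
    ext a b
    exact gram_symm y b a
  have := congrFun (congrFun (Matrix.transpose_nonsing_inv (g.gram c y)) j) i
  rw [h] at this
  exact this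

section Chart

variable (hc : c ∈ IsManifold.maximalAtlas 𝓘(ℝ, Coord n) ∞ M)
include hc

/-- Together with the next lemma this gives smoothness of g⁻¹ and of the Christoffel symbols on the
chart domain. -/
theorem gram_contDiffOn (i j : Fin n) : ContDiffOn ℝ ∞ (fun z => g.gram c z i j) c.target :=
  g.smooth c hc i j

theorem gram_det_ne_zero [IsManifold 𝓘(ℝ, Coord n) ∞ M] (hy : y ∈ c.target) :
    (g.gram c y).det ≠ 0 := by
  intro h0
  obtain ⟨v, hv0, hv⟩ := Matrix.exists_mulVec_eq_zero_iff.2 h0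
  have hmd : c.MDifferentiable 𝓘(ℝ, Coord n) 𝓘(ℝ, Coord n) :=
    ⟨(contMDiffOn_of_mem_maximalAtlas hc).mdifferentiableOn (by simp),
      (contMDiffOn_symm_of_mem_maximalAtlas hc).mdifferentiableOn (by simp)⟩
  have hbij := hmd.symm.mfderiv_bijective (x := y) hy
  let T : Coord n →ₗ[ℝ] TangentSpace 𝓘(ℝ, Coord n) (c.symm y) :=
    (mfderiv 𝓘(ℝ, Coord n) 𝓘(ℝ, Coord n) c.symm y : _ →L[ℝ] _).toLinearMap
  have hT : Function.Bijective T := hbij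
  let b : Coord n →ₗ[ℝ] Coord n →ₗ[ℝ] ℝ := (g.form (c.symm y)).compl₁₂ T T
  have hb : ∀ i j, b (EuclideanSpace.single j 1) (EuclideanSpace.single i 1) =
      g.gram c y i j := fun i j => by
    rw [gram_symm]; rfl
  have hexp : ∀ Z : Coord n, Z = ∑ i, Z i • EuclideanSpace.single i (1 : ℝ) := fun Z => by
    ext k
    simp [Pi.single_apply]
  -- A kernel vector of the Gram matrix is orthogonal to every coordinate vector. The differential
  -- of the inverse chart is bijective, so its image is orthogonal to the whole tangent space.
  have hzero : ∀ Z, b (WithLp.toLp 2 v) Z = 0 := by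
    intro Z
    have h1 : ∀ i, b (WithLp.toLp 2 v) (EuclideanSpace.single i 1) = 0 := by
      intro i
      rw [hexp (WithLp.toLp 2 v)]
      simp only [map_sum, map_smul, LinearMap.sum_apply, LinearMap.smul_apply, hb, smul_eq_mul]
      have := congrFun hv i
      simp only [Matrix.mulVec, dotProduct, Pi.zero_apply] at this
      rw [← this]
      exact Finset.sum_congr rfl fun j _ => mul_comm _ _
    rw [hexp Z]
    simp [map_sum, h1]
  have h2 : T (WithLp.toLp 2 v) = 0 := by
    refine g.nondegenerate _ _ fun w => ?_
    obtain ⟨Z, rfl⟩ := hT.2 w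
    exact hzero Z
  have h3 : WithLp.toLp 2 v = (0 : Coord n) := hT.1 (by rw [h2, map_zero])
  exact hv0 (by simpa using h3)

variable [IsManifold 𝓘(ℝ, Coord n) ∞ M]

theorem gram_isUnit_det (hy : y ∈ c.target) : IsUnit (g.gram c y).det :=
  (gram_det_ne_zero hc hy).isUnit

theorem gram_inv_contDiffOn (i j : Fin n) :
    ContDiffOn ℝ ∞ (fun z => (g.gram c z)⁻¹ i j) c.target :=
  ContDiffOn.matrix_inv (gram_contDiffOn hc) (fun _ hz => gram_det_ne_zero hc hz) i j

theorem christoffel_contDiffOn (k i j : Fin n) :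
    ContDiffOn ℝ ∞ (g.christoffel c k i j) c.target := by
  have h : ∀ a i j, ContDiffOn ℝ ∞ (partialD a (fun z => g.gram c z i j)) c.target :=
    fun a i j => (gram_contDiffOn hc i j).partialD c.open_target (by simp) a
  exact contDiffOn_const.mul (ContDiffOn.sum fun l _ =>
    (gram_inv_contDiffOn hc k l).mul (((h _ _ _).add (h _ _ _)).sub (h _ _ _)))

theorem hess_contDiffOn {k m : WithTop ℕ∞} (hk : k ≤ ∞) (hkm : k + 1 + 1 ≤ m)
    (hW : IsOpen W) (hWc : W ⊆ c.target) (hu : ContDiffOn ℝ m u W) (i j : Fin n) :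
    ContDiffOn ℝ k (g.hess c u i j) W := by
  have h1 : ∀ a, ContDiffOn ℝ (k + 1) (partialD a u) W := fun a => hu.partialD hW hkm a
  exact ((h1 j).partialD hW le_rfl i).sub (ContDiffOn.sum fun l _ =>
    (((christoffel_contDiffOn hc l i j).mono hWc).of_le hk).mul ((h1 l).of_le le_self_add))

theorem box_contDiffOn {k m : WithTop ℕ∞} (hk : k ≤ ∞) (hkm : k + 1 + 1 ≤ m)
    (hW : IsOpen W) (hWc : W ⊆ c.target) (hu : ContDiffOn ℝ m u W) :
    ContDiffOn ℝ k (g.box c u) W :=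
  ContDiffOn.sum fun i _ => ContDiffOn.sum fun j _ =>
    (((gram_inv_contDiffOn hc i j).mono hWc).of_le hk).mul
      (hess_contDiffOn hc hk hkm hW hWc hu i j)

theorem gram_mul_inv (hy : y ∈ c.target) (a : Fin n → ℝ) (i : Fin n) :
    ∑ j, g.gram c y i j * ∑ k, (g.gram c y)⁻¹ j k * a k = a i := by
  have h := congrFun (congrArg (fun A : Matrix (Fin n) (Fin n) ℝ => A.mulVec a)
    (Matrix.mul_nonsing_inv (g.gram c y) (gram_isUnit_det hc hy))) i
  simp only [← Matrix.mulVec_mulVec, Matrix.one_mulVec] at h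
  exact h

theorem gram_inv_mul (hy : y ∈ c.target) (a : Fin n → ℝ) (i : Fin n) :
    ∑ j, (g.gram c y)⁻¹ i j * ∑ k, g.gram c y j k * a k = a i := by
  have h := congrFun (congrArg (fun A : Matrix (Fin n) (Fin n) ℝ => A.mulVec a)
    (Matrix.nonsing_inv_mul (g.gram c y) (gram_isUnit_det hc hy))) i
  simp only [← Matrix.mulVec_mulVec, Matrix.one_mulVec] at h
  exact h

theorem eq_of_gram_mul_eq (hy : y ∈ c.target) {a b : Fin n → ℝ}
    (h : ∀ i, ∑ j, g.gram c y i j * a j = ∑ j, g.gram c y i j * b j) : a = b := by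
  funext i
  rw [← gram_inv_mul (g := g) hc hy a i, ← gram_inv_mul (g := g) hc hy b i]
  exact Finset.sum_congr rfl fun j _ => by rw [h]

theorem gram_mul_christoffel (hy : y ∈ c.target) (i j k : Fin n) :
    ∑ m, g.gram c y i m * g.christoffel c m j k y =
      (1 / 2 : ℝ) * (partialD j (fun z => g.gram c z k i) y +
        partialD k (fun z => g.gram c z j i) y - partialD i (fun z => g.gram c z j k) y) := by
  rw [← gram_mul_inv hc hy (fun i => (1 / 2 : ℝ) * (partialD j (fun z => g.gram c z k i) y +
        partialD k (fun z => g.gram c z j i) y - partialD i (fun z => g.gram c z j k) y)) i]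
  refine Finset.sum_congr rfl fun m _ => ?_
  simp only [christoffel, Finset.mul_sum]
  refine Finset.sum_congr rfl fun l _ => ?_
  ring

end Chart

/-- In the trace two of the three derivative terms cancel by symmetry of the inverse metric. What is
left is half the logarithmic derivative of det g, which is how the volume density enters. -/
theorem sum_christoffel (i : Fin n) :
    ∑ k, g.christoffel c k k i y =
      (1 / 2 : ℝ) * ∑ a, ∑ b, (g.gram c y)⁻¹ a b * partialD i (fun z => g.gram c z b a) y := by
  have hs : ∀ a b : Fin n, (fun z => g.gram c z a b) = fun z => g.gram c z b a :=
    fun a b => funext fun z => gram_symm z a b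
  have h1 : ∑ k, ∑ l, (g.gram c y)⁻¹ k l * partialD k (fun z => g.gram c z i l) y =
      ∑ k, ∑ l, (g.gram c y)⁻¹ k l * partialD l (fun z => g.gram c z k i) y := by
    rw [Finset.sum_comm]
    refine Finset.sum_congr rfl fun l _ => Finset.sum_congr rfl fun k _ => ?_
    rw [gram_inv_symm (g := g) y k l, hs i l]
  simp only [christoffel, ← Finset.mul_sum, mul_sub, mul_add, Finset.sum_add_distrib,
    Finset.sum_sub_distrib]
  rw [h1]
  rw [add_sub_cancel_left]
  congr 1
  refine Finset.sum_congr rfl fun l _ => Finset.sum_congr rfl fun k _ => ?_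
  rw [hs k l]

/-- The density `|det (g_{ij})|^{1/2}` of the volume measure in the chart `c`. -/
noncomputable def density (g : PseudoRiemannianMetric n M) (c : OpenPartialHomeomorph M (Coord n))
    (y : Coord n) : ℝ :=
  Real.sqrt |(g.gram c y).det|

/-- The components `gⁱʲ ∂ⱼ u` of the gradient of `u` in the chart `c`. -/
noncomputable def grad (g : PseudoRiemannianMetric n M) (c : OpenPartialHomeomorph M (Coord n))
    (u : Coord n → ℝ) (i : Fin n) (y : Coord n) : ℝ :=
  ∑ j, (g.gram c y)⁻¹ i j * partialD j u y

/-- The metric pairing `gⁱʲ ∂ᵢ u ∂ⱼ v` of two differentials in the chart `c`. -/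
noncomputable def pairing (g : PseudoRiemannianMetric n M) (c : OpenPartialHomeomorph M (Coord n))
    (u v : Coord n → ℝ) (y : Coord n) : ℝ :=
  ∑ i, partialD i u y * g.grad c v i y

/-- The covariant Hessian of `u` as a bilinear form on vectors. -/
noncomputable def hessForm (g : PseudoRiemannianMetric n M) (c : OpenPartialHomeomorph M (Coord n))
    (u : Coord n → ℝ) (y : Coord n) (X Y : Fin n → ℝ) : ℝ :=
  ∑ i, ∑ j, X i * Y j * g.hess c u i j y

theorem pairing_comm (u v : Coord n → ℝ) : g.pairing c u v y = g.pairing c v u y := by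
  simp only [pairing, grad, Finset.mul_sum]
  rw [Finset.sum_comm]
  refine Finset.sum_congr rfl fun i _ => Finset.sum_congr rfl fun j _ => ?_
  rw [gram_inv_symm]; ring

section Chart

variable (hc : c ∈ IsManifold.maximalAtlas 𝓘(ℝ, Coord n) ∞ M) [IsManifold 𝓘(ℝ, Coord n) ∞ M]
include hc

theorem density_pos (hy : y ∈ c.target) : 0 < g.density c y :=
  Real.sqrt_pos.2 (abs_pos.2 (gram_det_ne_zero hc hy))

theorem density_contDiffOn : ContDiffOn ℝ ∞ (g.density c) c.target := by
  intro y hy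
  have h := gram_det_ne_zero (g := g) hc hy
  have h1 := ContDiffOn.matrix_det (gram_contDiffOn (g := g) hc) y hy
  exact (h1.abs h).sqrt (abs_ne_zero.2 h)

/-- Jacobi's formula for det g, combined with the trace identity for the Christoffel symbols. The
sign of det g cancels against that of the derivative of the absolute value. -/
theorem partialD_density (hy : y ∈ c.target) (i : Fin n) :
    partialD i (g.density c) y = g.density c y * ∑ k, g.christoffel c k k i y := by
  have h0 := gram_det_ne_zero (g := g) hc hy
  have hd : ∀ a b, DifferentiableAt ℝ (fun z => g.gram c z a b) y := fun a b =>
    (gram_contDiffOn hc a b).differentiableAt_of_isOpen c.open_target hy (by simp)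
  have hdet : DifferentiableAt ℝ (fun z => (g.gram c z).det) y :=
    (ContDiffOn.matrix_det (gram_contDiffOn (g := g) hc)).differentiableAt_of_isOpen
      c.open_target hy (by simp)
  have hF : HasDerivAt (fun t : ℝ => Real.sqrt |t|)
      (1 / (2 * Real.sqrt |(g.gram c y).det|) * (SignType.sign (g.gram c y).det : ℝ))
      (g.gram c y).det :=
    (Real.hasDerivAt_sqrt (abs_ne_zero.2 h0)).comp _ (hasDerivAt_abs h0)
  have h1 := partialD_comp (u := fun z => (g.gram c z).det) hF hdet i
  rw [show g.density c = fun z => Real.sqrt |(g.gram c z).det| from rfl, h1,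
    partialD_det hd h0.isUnit, sum_christoffel]
  have h2 : (SignType.sign (g.gram c y).det : ℝ) * (g.gram c y).det =
      Real.sqrt |(g.gram c y).det| * Real.sqrt |(g.gram c y).det| := by
    rw [Real.mul_self_sqrt (abs_nonneg _), sign_mul_self]
  have h3 : Real.sqrt |(g.gram c y).det| ≠ 0 := (density_pos hc hy).ne'
  generalize (∑ a, ∑ b, (g.gram c y)⁻¹ a b * partialD i (fun z => g.gram c z b a) y) = S
  calc _ = 1 / (2 * Real.sqrt |(g.gram c y).det|) *
        ((SignType.sign (g.gram c y).det : ℝ) * (g.gram c y).det) * S := by ring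
    _ = _ := by rw [h2]; field_simp

theorem gram_mul_grad (hy : y ∈ c.target) (i : Fin n) :
    ∑ j, g.gram c y i j * g.grad c u j y = partialD i u y :=
  gram_mul_inv hc hy (fun i => partialD i u y) i

theorem grad_contDiffOn {k m : WithTop ℕ∞} (hk : k ≤ ∞) (hkm : k + 1 ≤ m)
    (hW : IsOpen W) (hWc : W ⊆ c.target) (hu : ContDiffOn ℝ m u W) (i : Fin n) :
    ContDiffOn ℝ k (g.grad c u i) W :=
  ContDiffOn.sum fun j _ =>
    (((gram_inv_contDiffOn hc i j).mono hWc).of_le hk).mul (hu.partialD hW hkm j)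

theorem pairing_contDiffOn {k m : WithTop ℕ∞} (hk : k ≤ ∞) (hkm : k + 1 ≤ m)
    (hW : IsOpen W) (hWc : W ⊆ c.target) (hu : ContDiffOn ℝ m u W) (hv : ContDiffOn ℝ m v W) :
    ContDiffOn ℝ k (g.pairing c u v) W :=
  ContDiffOn.sum fun i _ => (hu.partialD hW hkm i).mul (grad_contDiffOn hc hk hkm hW hWc hv i)

/-- Metric compatibility of the connection: raising an index commutes with covariant
differentiation. The identity is checked after lowering the index, by differentiating ∂ₐu =
g_{aj}∇ʲu, so that no derivative of the inverse metric is needed. -/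
theorem partialD_grad (hW : IsOpen W) (hWc : W ⊆ c.target) (hu : ContDiffOn ℝ 2 u W)
    (hy : y ∈ W) (k i : Fin n) :
    partialD k (g.grad c u i) y = ∑ j, (g.gram c y)⁻¹ i j * g.hess c u k j y -
      ∑ l, g.christoffel c i k l y * g.grad c u l y := by
  have hyt := hWc hy
  have hgd : ∀ a b, DifferentiableAt ℝ (fun z => g.gram c z a b) y := fun a b =>
    (gram_contDiffOn hc a b).differentiableAt_of_isOpen c.open_target hyt (by simp)
  have hud : ∀ j, DifferentiableAt ℝ (g.grad c u j) y := fun j =>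
    (grad_contDiffOn hc (k := 1) (by norm_num) (by norm_num) hW hWc hu
      j).differentiableAt_of_isOpen hW hy (by simp)
  suffices h : (fun i => partialD k (g.grad c u i) y) =
      fun i => ∑ j, (g.gram c y)⁻¹ i j * g.hess c u k j y -
        ∑ l, g.christoffel c i k l y * g.grad c u l y from congrFun h i
  refine eq_of_gram_mul_eq (g := g) hc hyt fun a => ?_
  have h1 : partialD k (partialD a u) y = ∑ j, (partialD k (fun z => g.gram c z a j) y *
      g.grad c u j y + g.gram c y a j * partialD k (g.grad c u j) y) := by
    have he : partialD a u =ᶠ[nhds y] fun z => ∑ j, g.gram c z a j * g.grad c u j z :=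
      Filter.eventually_of_mem (hW.mem_nhds hy) fun z hz => (gram_mul_grad hc (hWc hz) a).symm
    rw [he.partialD_eq, partialD_sum (F := fun j z => g.gram c z a j * g.grad c u j z) _
      fun j _ => (hgd a j).mul (hud j)]
    exact Finset.sum_congr rfl fun j _ => partialD_mul (hgd a j) (hud j) k
  have h2 : ∑ m, g.christoffel c m k a y * partialD m u y =
      ∑ l, (∑ m, g.gram c y l m * g.christoffel c m k a y) * g.grad c u l y := by
    have h : ∀ m, g.christoffel c m k a y * partialD m u y =
        ∑ l, g.gram c y l m * g.christoffel c m k a y * g.grad c u l y := fun m => by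
      rw [← gram_mul_grad hc hyt, Finset.mul_sum]
      refine Finset.sum_congr rfl fun l _ => ?_
      rw [gram_symm y m l]; ring
    simp only [h, Finset.sum_mul]
    rw [Finset.sum_comm]
  have h3 : ∑ j, g.gram c y a j * ∑ l, g.christoffel c j k l y * g.grad c u l y =
      ∑ l, (∑ j, g.gram c y a j * g.christoffel c j k l y) * g.grad c u l y := by
    simp only [Finset.mul_sum, Finset.sum_mul]
    rw [Finset.sum_comm]
    refine Finset.sum_congr rfl fun l _ => Finset.sum_congr rfl fun m _ => ?_
    ring
  have hs : ∀ a b : Fin n, (fun z => g.gram c z a b) = fun z => g.gram c z b a :=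
    fun a b => funext fun z => gram_symm z a b
  simp only [mul_sub, Finset.sum_sub_distrib]
  rw [gram_mul_inv hc hyt, h3, hess, h1, h2, Finset.sum_add_distrib]
  simp only [gram_mul_christoffel hc hyt]
  -- The two Christoffel symbols of the first kind, with the indices a and l exchanged, add up to ∂ₖ
  -- g_{al}.
  have h4 : ∑ j, partialD k (fun z => g.gram c z a j) y * g.grad c u j y =
      (∑ l, (1 / 2 : ℝ) * (partialD k (fun z => g.gram c z a l) y +
        partialD a (fun z => g.gram c z k l) y - partialD l (fun z => g.gram c z k a) y) *
        g.grad c u l y) +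
      ∑ l, (1 / 2 : ℝ) * (partialD k (fun z => g.gram c z l a) y +
        partialD l (fun z => g.gram c z k a) y - partialD a (fun z => g.gram c z k l) y) *
        g.grad c u l y := by
    rw [← Finset.sum_add_distrib]
    refine Finset.sum_congr rfl fun l _ => ?_
    rw [hs l a]; ring
  rw [h4]; ring

/-- The Christoffel terms from differentiating the gradient of v are exactly those completing ∂∂u to
the covariant Hessian of u. -/
theorem partialD_pairing (hW : IsOpen W) (hWc : W ⊆ c.target) (hu : ContDiffOn ℝ 2 u W)
    (hv : ContDiffOn ℝ 2 v W) (hy : y ∈ W) (k : Fin n) :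
    partialD k (g.pairing c u v) y =
      ∑ i, (g.hess c u k i y * g.grad c v i y + g.hess c v k i y * g.grad c u i y) := by
  have hvd : ∀ j, DifferentiableAt ℝ (g.grad c v j) y := fun j =>
    (grad_contDiffOn hc (k := 1) (by norm_num) (by norm_num) hW hWc hv
      j).differentiableAt_of_isOpen hW hy (by simp)
  have hud : ∀ j, DifferentiableAt ℝ (partialD j u) y := fun j =>
    (hu.partialD (k := 1) hW (by norm_num) j).differentiableAt_of_isOpen hW hy (by simp)
  have hA : ∑ i, partialD i u y * ∑ j, (g.gram c y)⁻¹ i j * g.hess c v k j y =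
      ∑ j, g.hess c v k j y * g.grad c u j y := by
    simp only [grad, Finset.mul_sum]
    rw [Finset.sum_comm]
    refine Finset.sum_congr rfl fun i _ => Finset.sum_congr rfl fun j _ => ?_
    rw [gram_inv_symm]; ring
  have hB : ∑ i, partialD i u y * ∑ l, g.christoffel c i k l y * g.grad c v l y =
      ∑ l, (∑ i, g.christoffel c i k l y * partialD i u y) * g.grad c v l y := by
    simp only [Finset.mul_sum, Finset.sum_mul]
    rw [Finset.sum_comm]
    refine Finset.sum_congr rfl fun i _ => Finset.sum_congr rfl fun j _ => ?_
    ring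
  change partialD k (fun z => ∑ i, partialD i u z * g.grad c v i z) y = _
  rw [partialD_sum (F := fun i z => partialD i u z * g.grad c v i z) _
    fun j _ => (hud j).mul (hvd j)]
  simp only [fun j => partialD_mul (hud j) (hvd j) k, partialD_grad hc hW hWc hv hy,
    mul_sub, Finset.sum_add_distrib, Finset.sum_sub_distrib]
  rw [hA, hB]
  simp only [hess, sub_mul, Finset.sum_sub_distrib]
  ring

/-- The divergence form of the wave operator: the derivative of the density cancels the traced
Christoffel term in the divergence of the gradient. All integrations by parts rest on it. -/
theorem sum_partialD_density_mul_grad (hW : IsOpen W) (hWc : W ⊆ c.target)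
    (hu : ContDiffOn ℝ 2 u W) (hy : y ∈ W) :
    ∑ i, partialD i (fun z => g.density c z * g.grad c u i z) y =
      g.density c y * g.box c u y := by
  have hud : ∀ j, DifferentiableAt ℝ (g.grad c u j) y := fun j =>
    (grad_contDiffOn hc (k := 1) (by norm_num) (by norm_num) hW hWc hu
      j).differentiableAt_of_isOpen hW hy (by simp)
  have hd : DifferentiableAt ℝ (g.density c) y :=
    (density_contDiffOn hc).differentiableAt_of_isOpen c.open_target (hWc hy) (by simp)
  have h1 : ∑ i, (∑ k, g.christoffel c k k i y) * g.grad c u i y =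
      ∑ i, ∑ l, g.christoffel c i i l y * g.grad c u l y := by
    simp only [Finset.sum_mul]
    rw [Finset.sum_comm]
  calc _ = g.density c y * (∑ i, (∑ k, g.christoffel c k k i y) * g.grad c u i y +
        ∑ i, partialD i (g.grad c u i) y) := by
        rw [← Finset.sum_add_distrib, Finset.mul_sum]
        refine Finset.sum_congr rfl fun i _ => ?_
        rw [partialD_mul hd (hud i), partialD_density hc (hWc hy)]; ring
    _ = _ := by
        rw [h1]
        simp only [partialD_grad hc hW hWc hu hy, Finset.sum_sub_distrib, box]
        ring

end Chart
end PseudoRiemannianMetric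

/-! ### Compact supports and integrals of derivatives -/

section CompactSupport

variable {E : Type*} [NormedAddCommGroup E] [NormedSpace ℝ E] {W : Set E} {a : E → ℝ}

theorem ContDiffOn.contDiff_of_tsupport_subset {k : WithTop ℕ∞} (ha : ContDiffOn ℝ k a W)
    (hW : IsOpen W) (hsub : tsupport a ⊆ W) : ContDiff ℝ k a := by
  rw [contDiff_iff_contDiffAt]
  intro y
  by_cases hy : y ∈ tsupport a
  · exact ha.contDiffAt (hW.mem_nhds (hsub hy))
  · exact contDiffAt_const.congr_of_eventuallyEq (notMem_tsupport_iff_eventuallyEq.1 hy)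

end CompactSupport

section Coordinates

variable {n : ℕ} {W : Set (Coord n)} {u v a : Coord n → ℝ} {y : Coord n}

theorem support_partialD_subset (u : Coord n → ℝ) (i : Fin n) :
    Function.support (partialD i u) ⊆ tsupport u := fun y hy => by
  by_contra h
  refine hy ?_
  rw [(notMem_tsupport_iff_eventuallyEq.1 h).partialD_eq i]
  exact partialD_const 0 i

theorem tsupport_partialD_subset (u : Coord n → ℝ) (i : Fin n) :
    tsupport (partialD i u) ⊆ tsupport u :=
  closure_minimal (support_partialD_subset u i) isClosed_closure

theorem integral_partialD_eq_zero (hu : ContDiff ℝ 1 u) (hcs : HasCompactSupport u) (i : Fin n) :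
    Integrable (partialD i u) ∧ ∫ y, partialD i u y = 0 := by
  have hi : Integrable (partialD i u) :=
    Continuous.integrable_of_hasCompactSupport
      (contDiffOn_univ.1 ((contDiffOn_univ.2 hu).partialD (k := 0) isOpen_univ (by norm_num) i)).continuous
      (hcs.mono' (support_partialD_subset u i))
  refine ⟨hi, ?_⟩
  have h := integral_mul_fderiv_eq_neg_fderiv_mul_of_integrable (μ := (volume : Measure (Coord n)))
    (f := fun _ => (1 : ℝ)) (g := u) (v := EuclideanSpace.single i (1 : ℝ))
    (by simp) (by simp only [one_mul]; exact hi)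
    (by simpa using hu.continuous.integrable_of_hasCompactSupport hcs)
    (fun _ _ => differentiableAt_const _) (fun _ _ => hu.differentiable (by simp) _)
  simpa [partialD] using h

theorem integrableOn_mul_of_tsupport_subset {b : Coord n → ℝ} (hW : IsOpen W)
    (ha : ContinuousOn a W) (hb : ContinuousOn b W) (hcs : HasCompactSupport a)
    (hsub : tsupport a ⊆ W) : IntegrableOn (fun y => a y * b y) W := by
  have h1 : tsupport (fun y => a y * b y) ⊆ tsupport a := tsupport_mul_subset_left
  exact (((ha.mul hb).continuous_of_tsupport_subset hW
    (h1.trans hsub)).integrable_of_hasCompactSupport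
      (hcs.mul_right)).integrableOn

end Coordinates

/-! ### Product and chain rules, conjugation, integration by parts -/

namespace PseudoRiemannianMetric

variable {n : ℕ} {M : Type*} [TopologicalSpace M] [ChartedSpace (Coord n) M]
  {g : PseudoRiemannianMetric n M} {c : OpenPartialHomeomorph M (Coord n)}
  {u v a f w φ ψ : Coord n → ℝ} {W : Set (Coord n)} {y : Coord n}

theorem pairing_eq_sum (u v : Coord n → ℝ) :
    g.pairing c u v y = ∑ i, ∑ j, (g.gram c y)⁻¹ i j * (partialD i u y * partialD j v y) := by
  simp only [pairing, grad, Finset.mul_sum]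
  exact Finset.sum_congr rfl fun i _ => Finset.sum_congr rfl fun j _ => by ring

theorem hess_comm (hu : ContDiffAt ℝ 2 u y) (i j : Fin n) :
    g.hess c u i j y = g.hess c u j i y := by
  have hs : ∀ a b : Fin n, (fun z => g.gram c z a b) = fun z => g.gram c z b a :=
    fun a b => funext fun z => gram_symm z a b
  have h1 : ∀ k, g.christoffel c k i j y = g.christoffel c k j i y := fun k => by
    simp only [christoffel, hs i j]
    congr 1
    exact Finset.sum_congr rfl fun l _ => by ring
  simp only [hess, h1, partialD_comm hu i j]

theorem hess_add (hW : IsOpen W) (hu : ContDiffOn ℝ 2 u W) (hv : ContDiffOn ℝ 2 v W)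
    (hy : y ∈ W) (i j : Fin n) :
    g.hess c (fun z => u z + v z) i j y = g.hess c u i j y + g.hess c v i j y := by
  have h1 : ∀ z ∈ W, DifferentiableAt ℝ u z := fun z hz =>
    hu.differentiableAt_of_isOpen hW hz (by simp)
  have h2 : ∀ z ∈ W, DifferentiableAt ℝ v z := fun z hz =>
    hv.differentiableAt_of_isOpen hW hz (by simp)
  have h3 : ∀ k, DifferentiableAt ℝ (partialD k u) y := fun k =>
    (hu.partialD (k := 1) hW (by norm_num) k).differentiableAt_of_isOpen hW hy (by simp)
  have h4 : ∀ k, DifferentiableAt ℝ (partialD k v) y := fun k =>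
    (hv.partialD (k := 1) hW (by norm_num) k).differentiableAt_of_isOpen hW hy (by simp)
  have h5 : partialD j (fun z => u z + v z) =ᶠ[nhds y] fun z => partialD j u z + partialD j v z :=
    Filter.eventually_of_mem (hW.mem_nhds hy) fun z hz => partialD_add (h1 z hz) (h2 z hz) j
  simp only [hess, h5.partialD_eq, partialD_add (h3 j) (h4 j), partialD_add (h1 y hy) (h2 y hy),
    mul_add, Finset.sum_add_distrib]
  ring

theorem hess_const_add (hW : IsOpen W) (hu : ContDiffOn ℝ 2 u W) (hy : y ∈ W) (r : ℝ)
    (i j : Fin n) : g.hess c (fun z => r + u z) i j y = g.hess c u i j y := by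
  rw [hess_add hW contDiffOn_const hu hy]
  simp [hess, funext fun z => partialD_const (n := n) (y := z) r j, partialD_const]

theorem hess_mul (hW : IsOpen W) (hu : ContDiffOn ℝ 2 u W) (hv : ContDiffOn ℝ 2 v W)
    (hy : y ∈ W) (i j : Fin n) :
    g.hess c (fun z => u z * v z) i j y = u y * g.hess c v i j y + v y * g.hess c u i j y +
      partialD i u y * partialD j v y + partialD j u y * partialD i v y := by
  have h1 : ∀ z ∈ W, DifferentiableAt ℝ u z := fun z hz =>
    hu.differentiableAt_of_isOpen hW hz (by simp)
  have h2 : ∀ z ∈ W, DifferentiableAt ℝ v z := fun z hz =>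
    hv.differentiableAt_of_isOpen hW hz (by simp)
  have h3 : ∀ k, DifferentiableAt ℝ (partialD k u) y := fun k =>
    (hu.partialD (k := 1) hW (by norm_num) k).differentiableAt_of_isOpen hW hy (by simp)
  have h4 : ∀ k, DifferentiableAt ℝ (partialD k v) y := fun k =>
    (hv.partialD (k := 1) hW (by norm_num) k).differentiableAt_of_isOpen hW hy (by simp)
  have h5 : partialD j (fun z => u z * v z) =ᶠ[nhds y]
      fun z => partialD j u z * v z + u z * partialD j v z :=
    Filter.eventually_of_mem (hW.mem_nhds hy) fun z hz => partialD_mul (h1 z hz) (h2 z hz) j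
  rw [hess, h5.partialD_eq,
    partialD_add (u := fun z => partialD j u z * v z) (v := fun z => u z * partialD j v z)
      ((h3 j).mul (h2 y hy)) ((h1 y hy).mul (h4 j)),
    partialD_mul (h3 j) (h2 y hy), partialD_mul (h1 y hy) (h4 j)]
  have h6 : ∑ k, g.christoffel c k i j y * partialD k (fun z => u z * v z) y =
      v y * ∑ k, g.christoffel c k i j y * partialD k u y +
        u y * ∑ k, g.christoffel c k i j y * partialD k v y := by
    simp only [partialD_mul (h1 y hy) (h2 y hy), Finset.mul_sum]
    rw [← Finset.sum_add_distrib]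
    exact Finset.sum_congr rfl fun k _ => by ring
  rw [h6]
  simp only [hess]
  ring

theorem hess_comp {F F' F'' : ℝ → ℝ} (hW : IsOpen W) (hu : ContDiffOn ℝ 2 u W)
    (hF : ∀ z ∈ W, HasDerivAt F (F' (u z)) (u z))
    (hF' : HasDerivAt F' (F'' (u y)) (u y))
    (hy : y ∈ W) (i j : Fin n) :
    g.hess c (fun z => F (u z)) i j y =
      F' (u y) * g.hess c u i j y + F'' (u y) * (partialD i u y * partialD j u y) := by
  have h1 : ∀ z ∈ W, DifferentiableAt ℝ u z := fun z hz =>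
    hu.differentiableAt_of_isOpen hW hz (by simp)
  have h3 : ∀ k, DifferentiableAt ℝ (partialD k u) y := fun k =>
    (hu.partialD (k := 1) hW (by norm_num) k).differentiableAt_of_isOpen hW hy (by simp)
  have h5 : partialD j (fun z => F (u z)) =ᶠ[nhds y] fun z => F' (u z) * partialD j u z :=
    Filter.eventually_of_mem (hW.mem_nhds hy) fun z hz => partialD_comp (hF z hz) (h1 z hz) j
  have h6 : DifferentiableAt ℝ (fun z => F' (u z)) y :=
    hF'.differentiableAt.comp y (h1 y hy)
  simp only [hess, h5.partialD_eq, partialD_mul h6 (h3 j), partialD_comp hF' (h1 y hy),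
    partialD_comp (hF y hy) (h1 y hy)]
  rw [mul_sub, Finset.mul_sum]
  have h7 : ∀ k, g.christoffel c k i j y * (F' (u y) * partialD k u y) =
    F' (u y) * (g.christoffel c k i j y * partialD k u y) := fun k => by ring
  simp only [h7]
  ring

theorem box_mul (hW : IsOpen W) (hu : ContDiffOn ℝ 2 u W) (hv : ContDiffOn ℝ 2 v W)
    (hy : y ∈ W) :
    g.box c (fun z => u z * v z) y =
      u y * g.box c v y + v y * g.box c u y + 2 * g.pairing c u v y := by
  rw [two_mul]
  nth_rewrite 2 [pairing_comm]
  simp only [box, hess_mul hW hu hv hy, pairing_eq_sum, Finset.mul_sum]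
  simp only [← Finset.sum_add_distrib]
  exact Finset.sum_congr rfl fun i _ => Finset.sum_congr rfl fun j _ => by ring

theorem box_comp {F F' F'' : ℝ → ℝ} (hW : IsOpen W) (hu : ContDiffOn ℝ 2 u W)
    (hF : ∀ z ∈ W, HasDerivAt F (F' (u z)) (u z))
    (hF' : HasDerivAt F' (F'' (u y)) (u y)) (hy : y ∈ W) :
    g.box c (fun z => F (u z)) y =
      F' (u y) * g.box c u y + F'' (u y) * g.pairing c u u y := by
  simp only [box, hess_comp hW hu hF hF' hy, pairing_eq_sum, Finset.mul_sum]
  simp only [← Finset.sum_add_distrib]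
  exact Finset.sum_congr rfl fun i _ => Finset.sum_congr rfl fun j _ => by ring

theorem pairing_of_partialD_eq_left {u₁ u₂ : Coord n → ℝ} {r s : ℝ}
    (h : ∀ i, partialD i u y = r * partialD i u₁ y + s * partialD i u₂ y) :
    g.pairing c u v y = r * g.pairing c u₁ v y + s * g.pairing c u₂ v y := by
  simp only [pairing, h, Finset.mul_sum]
  rw [← Finset.sum_add_distrib]
  exact Finset.sum_congr rfl fun i _ => by ring

theorem hasDerivAt_exp_const_mul (r t : ℝ) :
    HasDerivAt (fun t => Real.exp (r * t)) (r * Real.exp (r * t)) t :=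
  ((Real.hasDerivAt_exp (r * t)).comp t (hasDerivAt_const_mul r)).congr_deriv (mul_comm _ _)

theorem hasDerivAt_mul_exp_const_mul (r t : ℝ) :
    HasDerivAt (fun t => r * Real.exp (r * t)) (r * (r * Real.exp (r * t))) t :=
  (hasDerivAt_exp_const_mul r t).const_mul r

theorem box_exp (hW : IsOpen W) (hf : ContDiffOn ℝ 2 f W) (hy : y ∈ W) (r : ℝ) :
    g.box c (fun z => Real.exp (r * f z)) y =
      r * Real.exp (r * f y) * g.box c f y +
        r * (r * Real.exp (r * f y)) * g.pairing c f f y :=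
  box_comp (F := fun t => Real.exp (r * t)) (u := f) (F' := fun t => r * Real.exp (r * t)) (F'' := fun t => r * (r * Real.exp (r * t)))
    hW hf (fun _ _ => hasDerivAt_exp_const_mul r _) (hasDerivAt_mul_exp_const_mul r _) hy

theorem partialD_exp_mul (hf : DifferentiableAt ℝ f y) (hφ : DifferentiableAt ℝ φ y) (r : ℝ)
    (i : Fin n) :
    partialD i (fun z => Real.exp (r * f z) * φ z) y =
      Real.exp (r * f y) * partialD i φ y + r * Real.exp (r * f y) * φ y * partialD i f y := by
  rw [partialD_mul (u := fun z => Real.exp (r * f z)) (hf.const_mul _).exp hφ,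
    partialD_comp (hasDerivAt_exp_const_mul r _) hf]
  ring

/-- Conjugation of the wave operator by the exponential weight `exp (-lam f)`. -/
theorem box_exp_mul (hW : IsOpen W) (hf : ContDiffOn ℝ 2 f W) (hφ : ContDiffOn ℝ 2 φ W)
    (hy : y ∈ W) (lam : ℝ) (hψ : ∀ z, ψ z = Real.exp (-lam * f z) * φ z) :
    g.box c ψ y + 2 * lam * g.pairing c f ψ y + lam ^ 2 * g.pairing c f f y * ψ y +
      lam * g.box c f y * ψ y = Real.exp (-lam * f y) * g.box c φ y := by
  have hfd := hf.differentiableAt_of_isOpen hW hy (by simp)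
  have hφd := hφ.differentiableAt_of_isOpen hW hy (by simp)
  have hE2 : ContDiffOn ℝ 2 (fun z => Real.exp (-lam * f z)) W :=
    (contDiffOn_const.mul hf).exp
  have hψ' : ψ = fun z => Real.exp (-lam * f z) * φ z := funext hψ
  have h1 : g.box c ψ y = Real.exp (-lam * f y) * g.box c φ y +
      φ y * g.box c (fun z => Real.exp (-lam * f z)) y +
      2 * g.pairing c (fun z => Real.exp (-lam * f z)) φ y :=
    (congrArg (fun q => g.box c q y) hψ').trans (box_mul hW hE2 hφ hy)
  have h3 : g.pairing c (fun z => Real.exp (-lam * f z)) φ y =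
      -lam * Real.exp (-lam * f y) * g.pairing c f φ y + 0 * g.pairing c f φ y :=
    pairing_of_partialD_eq_left fun i => by
      rw [partialD_comp (hasDerivAt_exp_const_mul (-lam) _) hfd]; ring
  have h4 : g.pairing c f ψ y = Real.exp (-lam * f y) * g.pairing c f φ y +
      (-lam * Real.exp (-lam * f y) * φ y) * g.pairing c f f y := by
    rw [pairing_comm f ψ, pairing_comm f φ]
    exact pairing_of_partialD_eq_left fun i => by
      rw [hψ']; exact partialD_exp_mul hfd hφd _ i
  rw [h1, box_exp hW hf hy, h3, h4, hψ y]
  ring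

theorem support_pairing_subset (u v : Coord n → ℝ) :
    Function.support (g.pairing c u v) ⊆ tsupport v := fun y hy => by
  by_contra h
  refine hy ?_
  have h1 : ∀ i, partialD i v y = 0 := fun i =>
    Function.notMem_support.1 fun h2 => h (support_partialD_subset v i h2)
  simp [pairing_eq_sum, h1]

section Chart

variable (hc : c ∈ IsManifold.maximalAtlas 𝓘(ℝ, Coord n) ∞ M) [IsManifold 𝓘(ℝ, Coord n) ∞ M]
include hc

/-- Integration by parts for the wave operator. -/
theorem integral_mul_box_add_pairing (hW : IsOpen W) (hWc : W ⊆ c.target)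
    (ha : ContDiffOn ℝ 1 a W) (hu : ContDiffOn ℝ 2 u W) (hcs : HasCompactSupport a)
    (hsub : tsupport a ⊆ W) :
    IntegrableOn (fun y => (a y * g.box c u y + g.pairing c a u y) * g.density c y) W ∧
      ∫ y in W, (a y * g.box c u y + g.pairing c a u y) * g.density c y = 0 := by
  let F : Fin n → Coord n → ℝ := fun i y => a y * (g.density c y * g.grad c u i y)
  have hgr : ∀ i, ContDiffOn ℝ 1 (g.grad c u i) W := fun i =>
    grad_contDiffOn hc (by norm_num) (by norm_num) hW hWc hu i
  have hden : ContDiffOn ℝ 1 (g.density c) W :=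
    ((density_contDiffOn hc).mono hWc).of_le (by norm_num)
  have hFs : ∀ i, tsupport (F i) ⊆ tsupport a := fun i => tsupport_mul_subset_left
  -- The support of a lies in W, so the product is C¹ on the whole coordinate space and no boundary
  -- term appears.
  have hF : ∀ i, ContDiff ℝ 1 (F i) := fun i =>
    (ha.mul (hden.mul (hgr i))).contDiff_of_tsupport_subset hW ((hFs i).trans hsub)
  have hFc : ∀ i, HasCompactSupport (F i) := fun i => hcs.mul_right
  have hI := fun i => integral_partialD_eq_zero (hF i) (hFc i) i
  have hpt : Set.EqOn (fun y => ∑ i, partialD i (F i) y)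
      (fun y => (a y * g.box c u y + g.pairing c a u y) * g.density c y) W := by
    intro y hy
    have had := ha.differentiableAt_of_isOpen hW hy (by simp)
    have hgd : ∀ i, DifferentiableAt ℝ (fun z => g.density c z * g.grad c u i z) y := fun i =>
      (hden.mul (hgr i)).differentiableAt_of_isOpen hW hy (by simp)
    simp only [F, fun i => partialD_mul had (hgd i) i, Finset.sum_add_distrib, ← Finset.mul_sum,
      sum_partialD_density_mul_grad hc hW hWc hu hy, pairing]
    rw [add_mul, add_comm, Finset.sum_mul]
    congr 1
    · ring
    · exact Finset.sum_congr rfl fun i _ => by ring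
  have hint : Integrable (fun y => ∑ i, partialD i (F i) y) :=
    integrable_finsetSum _ fun i _ => (hI i).1
  refine ⟨hint.integrableOn.congr_fun hpt hW.measurableSet, ?_⟩
  rw [← setIntegral_congr_fun hW.measurableSet hpt,
    setIntegral_eq_integral_of_forall_compl_eq_zero, integral_finsetSum _ fun i _ => (hI i).1]
  · exact Finset.sum_eq_zero fun i _ => (hI i).2
  · intro y hy
    refine Finset.sum_eq_zero fun i _ => Function.notMem_support.1 fun h => hy ?_
    exact hsub (hFs i (support_partialD_subset _ i h))

end Chart
end PseudoRiemannianMetric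

/-! ### The energy identity -/

theorem MeasureTheory.integral_add_const_mul_eq_zero {α : Type*} [MeasurableSpace α]
    {ν : Measure α} {p q : α → ℝ} (hp : Integrable p ν ∧ ∫ x, p x ∂ν = 0)
    (hq : Integrable q ν ∧ ∫ x, q x ∂ν = 0) (r : ℝ) :
    Integrable (fun x => p x + r * q x) ν ∧ ∫ x, (p x + r * q x) ∂ν = 0 := by
  refine ⟨hp.1.add (hq.1.const_mul r), ?_⟩
  rw [integral_add hp.1 (hq.1.const_mul r), integral_const_mul, hp.2, hq.2]
  ring

namespace PseudoRiemannianMetric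

variable {n : ℕ} {M : Type*} [TopologicalSpace M] [ChartedSpace (Coord n) M]
  {g : PseudoRiemannianMetric n M} {c : OpenPartialHomeomorph M (Coord n)}
  {u v a f w φ ψ : Coord n → ℝ} {W : Set (Coord n)} {y : Coord n}

theorem hessForm_comm (hu : ContDiffAt ℝ 2 u y) (X Y : Fin n → ℝ) :
    g.hessForm c u y X Y = g.hessForm c u y Y X := by
  simp only [hessForm]
  rw [Finset.sum_comm]
  refine Finset.sum_congr rfl fun i _ => Finset.sum_congr rfl fun j _ => ?_
  rw [hess_comm hu]; ring

theorem tsupport_pairing_subset (u v : Coord n → ℝ) :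
    tsupport (g.pairing c u v) ⊆ tsupport v :=
  closure_minimal (support_pairing_subset u v) isClosed_closure

section Chart

variable (hc : c ∈ IsManifold.maximalAtlas 𝓘(ℝ, Coord n) ∞ M) [IsManifold 𝓘(ℝ, Coord n) ∞ M]
include hc

theorem pairing_pairing (hW : IsOpen W) (hWc : W ⊆ c.target) (hu : ContDiffOn ℝ 2 u W)
    (hv : ContDiffOn ℝ 2 v W) (hy : y ∈ W) (a : Coord n → ℝ) :
    g.pairing c (g.pairing c u v) a y =
      g.hessForm c u y (fun i => g.grad c a i y) (fun i => g.grad c v i y) +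
        g.hessForm c v y (fun i => g.grad c a i y) (fun i => g.grad c u i y) := by
  rw [pairing]
  simp only [partialD_pairing hc hW hWc hu hv hy, hessForm, ← Finset.sum_add_distrib,
    Finset.sum_mul]
  exact Finset.sum_congr rfl fun i _ => Finset.sum_congr rfl fun j _ => by ring

/-- The energy identity for the multiplier `⟨df, dψ⟩ + w ψ` of the operator
`□ + 2 lam ⟨df, d·⟩ + lam² ⟨df, df⟩`. -/
theorem integral_multiplier_identity (hW : IsOpen W) (hWc : W ⊆ c.target)
    (hf : ContDiffOn ℝ 2 f W) (hψ : ContDiffOn ℝ 2 ψ W) (hw : ContDiffOn ℝ 1 w W)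
    (hcs : HasCompactSupport ψ) (hsub : tsupport ψ ⊆ W) (lam : ℝ) :
    let N : Coord n → ℝ := fun y =>
      (g.box c ψ y + 2 * lam * g.pairing c f ψ y + lam ^ 2 * g.pairing c f f y * ψ y) *
          (g.pairing c f ψ y + w y * ψ y) -
        (2 * lam * g.pairing c f ψ y ^ 2 +
          (-g.hessForm c f y (fun i => g.grad c ψ i y) (fun i => g.grad c ψ i y) +
            (2⁻¹ * g.box c f y - w y) * g.pairing c ψ ψ y) +
          lam ^ 2 * ψ y ^ 2 *
            (-g.hessForm c f y (fun i => g.grad c f i y) (fun i => g.grad c f i y) -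
              (2⁻¹ * g.box c f y - w y) * g.pairing c f f y) +
          2 * lam * w y * ψ y * g.pairing c f ψ y - ψ y * g.pairing c w ψ y)
    IntegrableOn (fun y => N y * g.density c y) W ∧ ∫ y in W, N y * g.density c y = 0 := by
  intro N
  have hp : ∀ {u v : Coord n → ℝ}, ContDiffOn ℝ 2 u W → ContDiffOn ℝ 2 v W →
      ContDiffOn ℝ 1 (g.pairing c u v) W := fun hu hv =>
    pairing_contDiffOn hc (by norm_num) (by norm_num) hW hWc hu hv
  have hψ1 : ContDiffOn ℝ 1 ψ W := hψ.of_le (by norm_num)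
  have hs1 : ∀ u : Coord n → ℝ, tsupport (g.pairing c u ψ) ⊆ W :=
    fun u => (tsupport_pairing_subset u ψ).trans hsub
  have hs2 : ∀ u : Coord n → ℝ, HasCompactSupport (g.pairing c u ψ) :=
    fun u => hcs.mono' (support_pairing_subset u ψ)
  have hs3 : tsupport (fun z => w z * ψ z) ⊆ tsupport ψ := tsupport_mul_subset_right
  have hs4 : tsupport (fun z => g.pairing c f f z * ψ z * ψ z) ⊆ tsupport ψ :=
    tsupport_mul_subset_right
  -- Four integrations by parts. The first treats ⟨df,dψ⟩□ψ and leaves D²ψ(∇ψ,∇f), which is half the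
  -- derivative of ⟨dψ,dψ⟩ along ∇f and is removed by the second. The third treats wψ□ψ, the fourth
  -- λ²⟨df,df⟩ψ⟨df,dψ⟩. None differentiates □f, so f of class C² suffices.
  have I1 := integral_mul_box_add_pairing (g := g) hc hW hWc (hp hf hψ) hψ (hs2 f) (hs1 f)
  have I2 := integral_mul_box_add_pairing (g := g) hc hW hWc (hp hψ hψ) hf (hs2 ψ) (hs1 ψ)
  have I3 := integral_mul_box_add_pairing (g := g) (a := fun z => w z * ψ z) hc hW hWc (hw.mul hψ1) hψ
    hcs.mul_left (hs3.trans hsub)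
  have I4 := integral_mul_box_add_pairing (g := g) (a := fun z => g.pairing c f f z * ψ z * ψ z)
    hc hW hWc (((hp hf hf).mul hψ1).mul hψ1) hf hcs.mul_left (hs4.trans hsub)
  have hpt : Set.EqOn (fun y =>
      (g.pairing c f ψ y * g.box c ψ y + g.pairing c (g.pairing c f ψ) ψ y) * g.density c y +
      (-2⁻¹) * ((g.pairing c ψ ψ y * g.box c f y + g.pairing c (g.pairing c ψ ψ) f y) *
        g.density c y) +
      1 * ((w y * ψ y * g.box c ψ y + g.pairing c (fun z => w z * ψ z) ψ y) * g.density c y) +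
      (2⁻¹ * lam ^ 2) * ((g.pairing c f f y * ψ y * ψ y * g.box c f y +
        g.pairing c (fun z => g.pairing c f f z * ψ z * ψ z) f y) * g.density c y))
      (fun y => N y * g.density c y) W := by
    intro y hy
    have hψd := hψ1.differentiableAt_of_isOpen hW hy (by simp)
    have hwd := hw.differentiableAt_of_isOpen hW hy (by simp)
    have hGd := (hp hf hf).differentiableAt_of_isOpen hW hy (by simp)
    have e3 : g.pairing c (fun z => w z * ψ z) ψ y =
        ψ y * g.pairing c w ψ y + w y * g.pairing c ψ ψ y :=
      pairing_of_partialD_eq_left fun i => by rw [partialD_mul hwd hψd]; ring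
    have e4 : g.pairing c (fun z => g.pairing c f f z * ψ z * ψ z) f y =
        (ψ y ^ 2) * g.pairing c (g.pairing c f f) f y +
          (2 * g.pairing c f f y * ψ y) * g.pairing c ψ f y :=
      pairing_of_partialD_eq_left fun i => by
        rw [partialD_mul (u := fun z => g.pairing c f f z * ψ z) (hGd.mul hψd) hψd,
          partialD_mul hGd hψd]; ring
    simp only [N, e3, e4, pairing_pairing hc hW hWc hf hψ hy, pairing_pairing hc hW hWc hψ hψ hy,
      pairing_pairing hc hW hWc hf hf hy, pairing_comm ψ f,
      hessForm_comm (hψ.contDiffAt (hW.mem_nhds hy)) (fun i => g.grad c f i y)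
        (fun i => g.grad c ψ i y)]
    ring
  have hI := integral_add_const_mul_eq_zero (integral_add_const_mul_eq_zero
    (integral_add_const_mul_eq_zero I1 I2 (-2⁻¹)) I3 1) I4 (2⁻¹ * lam ^ 2)
  refine ⟨IntegrableOn.congr_fun hI.1 hpt hW.measurableSet, ?_⟩
  rw [← setIntegral_congr_fun hW.measurableSet hpt]
  exact hI.2

end Chart
end PseudoRiemannianMetric

/-! ### Quadratic forms and scalar inequalities -/

section QuadraticForms

variable {ι : Type*} [Fintype ι]

theorem sq_sum_sum_mul_le (a b : ι → ι → ℝ) :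
    (∑ i, ∑ j, a i j * b i j) ^ 2 ≤ (∑ i, ∑ j, a i j ^ 2) * ∑ i, ∑ j, b i j ^ 2 := by
  have h := Finset.sum_mul_sq_le_sq_mul_sq (Finset.univ : Finset (ι × ι))
    (fun p => a p.1 p.2) (fun p => b p.1 p.2)
  simpa only [Fintype.sum_prod_type] using h

theorem abs_quadratic_le {a : ι → ι → ℝ} {r : ℝ} (hr : 0 ≤ r) (ha : ∑ i, ∑ j, a i j ^ 2 ≤ r ^ 2)
    (X : ι → ℝ) : |∑ i, ∑ j, X i * X j * a i j| ≤ r * ∑ i, X i ^ 2 := by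
  have hN : 0 ≤ ∑ i, X i ^ 2 := Finset.sum_nonneg fun i _ => sq_nonneg _
  refine abs_le_of_sq_le_sq ?_ (mul_nonneg hr hN)
  have h1 := sq_sum_sum_mul_le (fun i j => X i * X j) a
  have h2 : ∑ i, ∑ j, (X i * X j) ^ 2 = (∑ i, X i ^ 2) ^ 2 := by
    rw [sq (∑ i, X i ^ 2), Finset.sum_mul_sum]
    exact Finset.sum_congr rfl fun i _ => Finset.sum_congr rfl fun j _ => mul_pow _ _ _
  calc _ ≤ _ := h1
    _ ≤ (∑ i, X i ^ 2) ^ 2 * r ^ 2 := by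
        rw [h2]; exact mul_le_mul_of_nonneg_left ha (sq_nonneg _)
    _ = _ := by ring

theorem sum_sq_mulVec_le {a : ι → ι → ℝ} {r : ℝ} (ha : ∑ i, ∑ j, a i j ^ 2 ≤ r) (X : ι → ℝ) :
    ∑ i, (∑ j, a i j * X j) ^ 2 ≤ r * ∑ i, X i ^ 2 := by
  calc _ ≤ ∑ i, (∑ j, a i j ^ 2) * ∑ j, X j ^ 2 :=
        Finset.sum_le_sum fun i _ => Finset.sum_mul_sq_le_sq_mul_sq _ _ _
    _ ≤ _ := by
        rw [← Finset.sum_mul]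
        exact mul_le_mul_of_nonneg_right ha (Finset.sum_nonneg fun i _ => sq_nonneg _)

theorem sum_add_sq_le (X Y : ι → ℝ) :
    ∑ i, (X i + Y i) ^ 2 ≤ 2 * ∑ i, X i ^ 2 + 2 * ∑ i, Y i ^ 2 := by
  rw [Finset.mul_sum, Finset.mul_sum, ← Finset.sum_add_distrib]
  exact Finset.sum_le_sum fun i _ => by nlinarith [sq_nonneg (X i - Y i)]

end QuadraticForms

/-- The smallness of `ε` needed for the coercivity of the Carleman weight, relative to the
convexity constant `K` and a bound `Γ` of the metric. -/
structure IsSmallScale (K Γ ε : ℝ) : Prop where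
  pos : 0 < ε
  le_quarter : ε ≤ 1 / 4
  mul_le_one : 8 * K * ε ≤ 1
  error_le : 2 * K * ε ^ 4 + ε ^ 2 + 2⁻¹ * (Γ ^ 2 * ε ^ 2) ≤ 2⁻¹ * K⁻¹
  pow_four_le : ε ^ 4 ≤ 4⁻¹ * (K⁻¹) ^ 2
  gain : 16 * K ^ 3 * Γ ^ 2 * (2 * (K + Γ) ^ 2 + 1) * ε ≤ 1

/-- Apart from positivity of ε, each condition is continuous in ε and strict at ε = 0. -/
theorem exists_isSmallScale {K : ℝ} (hK : 0 < K) (Γ : ℝ) :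
    ∃ ε₀ : ℝ, 0 < ε₀ ∧ ∀ ε, 0 < ε → ε < ε₀ → IsSmallScale K Γ ε := by
  have key : ∀ (p : ℝ → ℝ) (r : ℝ), Continuous p → p 0 < r → ∀ᶠ ε in nhds (0 : ℝ), p ε ≤ r :=
    fun p r hp h0 => (hp.continuousAt.eventually (gt_mem_nhds h0)).mono fun _ h => le_of_lt h
  have hK' : 0 < K⁻¹ := inv_pos.2 hK
  have h := (key (fun ε => ε) (1 / 4) (by fun_prop) (by norm_num)).and
    ((key (fun ε => 8 * K * ε) 1 (by fun_prop) (by norm_num)).and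
    ((key (fun ε => 2 * K * ε ^ 4 + ε ^ 2 + 2⁻¹ * (Γ ^ 2 * ε ^ 2)) (2⁻¹ * K⁻¹) (by fun_prop)
      (by simpa using hK)).and
    ((key (fun ε => ε ^ 4) (4⁻¹ * (K⁻¹) ^ 2) (by fun_prop) (by simp; positivity)).and
    (key (fun ε => 16 * K ^ 3 * Γ ^ 2 * (2 * (K + Γ) ^ 2 + 1) * ε) 1 (by fun_prop)
      (by norm_num)))))
  obtain ⟨δ, hδ, H⟩ := Metric.eventually_nhds_iff.1 h
  refine ⟨δ, hδ, fun ε h0 h1 => ?_⟩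
  obtain ⟨a1, a2, a3, a4, a5⟩ := @H ε (by simpa [abs_of_pos h0] using h1)
  exact ⟨h0, a1, a2, a3, a4, a5⟩

/-- Algebra of coercivity at a vector Y, with N = |Y|², a and e the Hessians of h and of the
perturbation, D and q their derivatives along Y, γ = g(Y,Y) and b the wave operator of the
perturbation. Replacing D by D + q costs errors that use up half of K⁻¹N. The remaining loss
2Ks(D+q)² is at most half of s²(D+q)² because s ≥ 4K. -/
theorem convexity_lower_bound {K Γ ε s N a e b γ D q μ : ℝ} (hs : 4 * K ≤ s) (hK : 0 < K)
    (hN : 0 ≤ N) (h1 : K⁻¹ * N ≤ μ * γ - a + K * D ^ 2) (hq : q ^ 2 ≤ ε ^ 4 * N)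
    (he : e ≤ ε ^ 2 * N) (hb : -(Γ ^ 2 * ε ^ 2 * N) ≤ b * γ)
    (hε : 2 * K * ε ^ 4 + ε ^ 2 + 2⁻¹ * (Γ ^ 2 * ε ^ 2) ≤ 2⁻¹ * K⁻¹) :
    2⁻¹ * K⁻¹ * s * N + 2⁻¹ * (s * (D + q)) ^ 2 ≤
      -(s * (a + e) - s ^ 2 * (D + q) ^ 2) + s * (μ + 2⁻¹ * b) * γ := by
  have hD : D ^ 2 ≤ 2 * (D + q) ^ 2 + 2 * q ^ 2 := by nlinarith [sq_nonneg (D + q + q)]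
  have hDK := mul_le_mul_of_nonneg_left hD hK.le
  have hqK := mul_le_mul_of_nonneg_left hq hK.le
  have hεN := mul_le_mul_of_nonneg_right hε hN
  have key : 2⁻¹ * K⁻¹ * N - 2 * K * (D + q) ^ 2 ≤ μ * γ - a - e + 2⁻¹ * (b * γ) := by
    linarith
  have hs0 : 0 ≤ s := by linarith
  have h2 := mul_le_mul_of_nonneg_left key hs0
  have h3 : 0 ≤ (s - 4 * K) * (s * (D + q) ^ 2) :=
    mul_nonneg (by linarith) (mul_nonneg hs0 (sq_nonneg _))
  nlinarith

/-- Here G = ⟨df,df⟩, N = |∇f|² and B is the quadratic form at ∇f. Completing the square gives ½G² −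
2w'G ≥ −2w'², and w' is at most s(K+Γ) in size. Since N = s²p with p bounded below, the term of
order s³ absorbs this and leaves at least 1. -/
theorem transversal_lower_bound {K Γ ε s N G w' b μ B P p : ℝ} (hK : 0 < K) (hΓ : 0 < Γ)
    (hs : 1 ≤ 2 * ε * s) (hε : IsSmallScale K Γ ε)
    (hB : 2⁻¹ * K⁻¹ * s * N + 2⁻¹ * (s * P) ^ 2 ≤ B) (hP : s * P = G)
    (hN : N = s ^ 2 * p) (hp : 4⁻¹ * (K⁻¹) ^ 2 ≤ Γ ^ 2 * p)
    (hw : w' = s * (μ + 2⁻¹ * b)) (hμ : |μ| ≤ K) (hb : |b| ≤ Γ) :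
    1 ≤ B - 2 * w' * G := by
  have hε0 := hε.pos
  have hs0 : 0 < s := by
    by_contra h
    nlinarith [mul_nonneg hε0.le (neg_nonneg.2 (not_lt.1 h))]
  have hs1 : 2 ≤ s := by nlinarith [hε.le_quarter]
  have h1 : w' ^ 2 ≤ s ^ 2 * (K + Γ) ^ 2 := by
    have h3 : |μ + 2⁻¹ * b| ≤ K + Γ := by
      refine (abs_add_le _ _).trans ?_
      rw [abs_mul, abs_of_pos (by norm_num : (0 : ℝ) < 2⁻¹)]
      linarith [abs_nonneg b]
    rw [hw, mul_pow]
    exact mul_le_mul_of_nonneg_left (sq_le_sq' (abs_le.1 h3).1 (abs_le.1 h3).2) (sq_nonneg _)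
  have h2 : 2 * (K + Γ) ^ 2 + 1 ≤ 2⁻¹ * K⁻¹ * s * p := by
    set R := 2 * (K + Γ) ^ 2 + 1 with hR
    have hRp : 0 < R := by positivity
    -- This combines the gain condition on ε with s ≥ 1/(2ε).
    have h3 : 8 * K ^ 3 * Γ ^ 2 * R ≤ s := by
      have := mul_le_mul_of_nonneg_right hε.gain hs0.le
      have h4 : 8 * K ^ 3 * Γ ^ 2 * R * 1 ≤ 8 * K ^ 3 * Γ ^ 2 * R * (2 * ε * s) :=
        mul_le_mul_of_nonneg_left hs (by positivity)
      nlinarith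
    have hp' : 1 ≤ 4 * K ^ 2 * Γ ^ 2 * p := by
      have := mul_le_mul_of_nonneg_left hp (by positivity : 0 ≤ 4 * K ^ 2)
      have h5 : 4 * K ^ 2 * (4⁻¹ * (K⁻¹) ^ 2) = 1 := by field_simp
      linarith
    have hp0 : 0 < p := by
      by_contra h
      have : 4 * K ^ 2 * Γ ^ 2 * p ≤ 0 :=
        mul_nonpos_of_nonneg_of_nonpos (by positivity) (not_lt.1 h)
      linarith
    calc R = R * 1 := (mul_one R).symm
      _ ≤ R * (4 * K ^ 2 * Γ ^ 2 * p) := mul_le_mul_of_nonneg_left hp' hRp.le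
      _ = 2⁻¹ * K⁻¹ * (8 * K ^ 3 * Γ ^ 2 * R) * p := by field_simp; ring
      _ ≤ 2⁻¹ * K⁻¹ * s * p := by gcongr
  have h3 : s ^ 2 * (2 * (K + Γ) ^ 2 + 1) ≤ 2⁻¹ * K⁻¹ * s * N := by
    rw [hN]
    calc _ ≤ s ^ 2 * (2⁻¹ * K⁻¹ * s * p) := mul_le_mul_of_nonneg_left h2 (sq_nonneg _)
      _ = _ := by ring
  rw [hP] at hB
  have h4 : 1 ≤ s ^ 2 := by nlinarith
  nlinarith [sq_nonneg (G - 2 * w')]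

/-! ### Coercivity of the logarithmic weight -/

namespace PseudoRiemannianMetric

variable {n : ℕ} {M : Type*} [TopologicalSpace M] [ChartedSpace (Coord n) M]
  {g : PseudoRiemannianMetric n M} {c : OpenPartialHomeomorph M (Coord n)}
  {h E : Coord n → ℝ} {W : Set (Coord n)} {y : Coord n} {K Γ ε μ : ℝ}

/-- The convexity condition at a point with coordinates `y`, for a function of the coordinates. -/
def ConvexAt (g : PseudoRiemannianMetric n M) (c : OpenPartialHomeomorph M (Coord n))
    (h : Coord n → ℝ) (K μ : ℝ) (y : Coord n) : Prop :=
  K⁻¹ ≤ diffNorm h y ∧ ∀ Y : Fin n → ℝ, K⁻¹ * ∑ a, Y a ^ 2 ≤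
    (∑ a, ∑ b, Y a * Y b * (μ * g.gram c y a b - g.hess c h a b y)) +
      K * (∑ a, Y a * partialD a h y) ^ 2

/-- The metric and its inverse are bounded by `Γ` at `y`. -/
def BoundedAt (g : PseudoRiemannianMetric n M) (c : OpenPartialHomeomorph M (Coord n))
    (Γ : ℝ) (y : Coord n) : Prop :=
  ∑ i, ∑ j, g.gram c y i j ^ 2 ≤ Γ ^ 2 ∧ ∑ i, ∑ j, (g.gram c y)⁻¹ i j ^ 2 ≤ Γ ^ 2

/-- `E` is an admissible perturbation of `h` on the open set `W` at scale `ε`. -/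
structure IsPerturbation (g : PseudoRiemannianMetric n M)
    (c : OpenPartialHomeomorph M (Coord n)) (h : Coord n → ℝ) (ε : ℝ) (W : Set (Coord n))
    (E : Coord n → ℝ) : Prop where
  isOpen : IsOpen W
  contDiffOn : ContDiffOn ℝ 2 E W
  abs_base_le : ∀ y ∈ W, |h y| ≤ 2⁻¹ * ε
  abs_error_le : ∀ y ∈ W, |E y| ≤ ε ^ 2
  partialD_le : ∀ y ∈ W, ∑ i, partialD i E y ^ 2 ≤ ε ^ 4
  hess_le : ∀ y ∈ W, ∑ i, ∑ j, g.hess c E i j y ^ 2 ≤ ε ^ 4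

/-- The lower order part of the multiplier in the energy estimate. -/
noncomputable def multiplier (g : PseudoRiemannianMetric n M)
    (c : OpenPartialHomeomorph M (Coord n)) (h E : Coord n → ℝ) (ε μ : ℝ) (y : Coord n) : ℝ :=
  2⁻¹ * ((g.box c h y - 2 * μ) * (ε + h y + E y)⁻¹ -
    g.pairing c (carlemanWeight ε h E) (carlemanWeight ε h E) y)

namespace IsPerturbation

/-- The perturbation is at most ε² ≤ ε/4 and h at most ε/2 in size, so the argument of the logarithm
is comparable to ε. -/
theorem quarter_le (hE : g.IsPerturbation c h ε W E) (hε : 0 < ε) (hε' : ε ≤ 1 / 4) (hy : y ∈ W) :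
    ε / 4 ≤ ε + h y + E y := by
  have h1 := abs_le.1 (hE.abs_base_le y hy)
  have h2 := abs_le.1 (hE.abs_error_le y hy)
  nlinarith

theorem le_two_mul (hE : g.IsPerturbation c h ε W E) (hε : 0 < ε) (hε' : ε ≤ 1 / 4)
    (hy : y ∈ W) : ε + h y + E y ≤ 2 * ε := by
  have h1 := abs_le.1 (hE.abs_base_le y hy)
  have h2 := abs_le.1 (hE.abs_error_le y hy)
  nlinarith

theorem one_le_inv (hE : g.IsPerturbation c h ε W E) (hε : 0 < ε) (hε' : ε ≤ 1 / 4)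
    (hy : y ∈ W) : 1 ≤ 2 * ε * (ε + h y + E y)⁻¹ := by
  have h1 := hE.quarter_le hε hε' hy
  have h2 := hE.le_two_mul hε hε' hy
  rw [← div_eq_mul_inv, one_le_div (by linarith)]
  exact h2

theorem pos (hE : g.IsPerturbation c h ε W E) (hε : 0 < ε) (hε' : ε ≤ 1 / 4) (hy : y ∈ W) :
    0 < ε + h y + E y := by
  linarith [hE.quarter_le hε hε' hy]

section Argument

variable (hh : ContDiffOn ℝ 2 h W) (hE : g.IsPerturbation c h ε W E)
include hh hE

theorem contDiffOn_argument : ContDiffOn ℝ 2 (fun z => ε + h z + E z) W :=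
  (contDiffOn_const.add hh).add hE.contDiffOn

theorem partialD_argument (hy : y ∈ W) (i : Fin n) :
    partialD i (fun z => ε + h z + E z) y = partialD i h y + partialD i E y := by
  have h1 := hh.differentiableAt_of_isOpen hE.isOpen hy (by simp)
  rw [partialD_add (u := fun z => ε + h z) ((differentiableAt_const ε).add h1)
    (hE.contDiffOn.differentiableAt_of_isOpen hE.isOpen hy (by simp)),
    partialD_add (differentiableAt_const ε) h1, partialD_const, zero_add]

theorem hess_argument (hy : y ∈ W) (i j : Fin n) :
    g.hess c (fun z => ε + h z + E z) i j y = g.hess c h i j y + g.hess c E i j y := by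
  rw [hess_add (u := fun z => ε + h z) hE.isOpen (contDiffOn_const.add hh) hE.contDiffOn hy,
    hess_const_add hE.isOpen hh hy]

end Argument

variable (hε : 0 < ε) (hε' : ε ≤ 1 / 4) (hh : ContDiffOn ℝ 2 h W)
  (hE : g.IsPerturbation c h ε W E)
include hε hε' hh hE

theorem contDiffOn_weight : ContDiffOn ℝ 2 (carlemanWeight ε h E) W :=
  (hE.contDiffOn_argument hh).log fun _ hy => (hE.pos hε hε' hy).ne'

theorem partialD_weight (hy : y ∈ W) (i : Fin n) :
    partialD i (carlemanWeight ε h E) y =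
      (ε + h y + E y)⁻¹ * (partialD i h y + partialD i E y) := by
  rw [← hE.partialD_argument hh hy]
  exact partialD_comp (u := fun z => ε + h z + E z)
    (Real.hasDerivAt_log (hE.pos hε hε' hy).ne')
    ((hE.contDiffOn_argument hh).differentiableAt_of_isOpen hE.isOpen hy (by simp)) i

/-- The concavity of the logarithm puts a nonnegative square into −D²f; it supplies positivity in
the direction transversal to the level sets. -/
theorem hess_weight (hy : y ∈ W) (i j : Fin n) :
    g.hess c (carlemanWeight ε h E) i j y =
      (ε + h y + E y)⁻¹ * (g.hess c h i j y + g.hess c E i j y) -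
        ((ε + h y + E y)⁻¹) ^ 2 * ((partialD i h y + partialD i E y) *
          (partialD j h y + partialD j E y)) := by
  rw [← hE.hess_argument hh hy, ← hE.partialD_argument hh hy,
    ← hE.partialD_argument hh hy]
  have := hess_comp (g := g) (c := c) (F := Real.log) (u := fun z => ε + h z + E z)
    (F' := fun t => t⁻¹) (F'' := fun t => -(t ^ 2)⁻¹) hE.isOpen
    (hE.contDiffOn_argument hh)
    (fun z hz => Real.hasDerivAt_log (hE.pos hε hε' hz).ne')
    (hasDerivAt_inv (hE.pos hε hε' hy).ne') hy i j
  refine Eq.trans this ?_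
  rw [inv_pow]
  ring

theorem grad_weight (hy : y ∈ W) (i : Fin n) :
    g.grad c (carlemanWeight ε h E) i y =
      (ε + h y + E y)⁻¹ * (g.grad c h i y + g.grad c E i y) := by
  simp only [grad, hE.partialD_weight hε hε' hh hy]
  rw [← Finset.sum_add_distrib, Finset.mul_sum]
  exact Finset.sum_congr rfl fun j _ => by ring

theorem pairing_weight (hy : y ∈ W) :
    g.pairing c (carlemanWeight ε h E) (carlemanWeight ε h E) y =
      (ε + h y + E y)⁻¹ * ∑ i, g.grad c (carlemanWeight ε h E) i y *
        (partialD i h y + partialD i E y) := by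
  simp only [pairing, hE.partialD_weight hε hε' hh hy, Finset.mul_sum]
  exact Finset.sum_congr rfl fun j _ => by ring

theorem box_weight (hy : y ∈ W) :
    g.box c (carlemanWeight ε h E) y = (ε + h y + E y)⁻¹ * (g.box c h y + g.box c E y) -
      g.pairing c (carlemanWeight ε h E) (carlemanWeight ε h E) y := by
  simp only [box, pairing_eq_sum, hE.partialD_weight hε hε' hh hy, hE.hess_weight hε hε' hh hy]
  simp only [← Finset.sum_add_distrib, Finset.mul_sum, ← Finset.sum_sub_distrib]
  exact Finset.sum_congr rfl fun i _ => Finset.sum_congr rfl fun j _ => by ring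

/-- This identity explains the choice of the multiplier. The term with □E is kept on the right, as
an error of size ε², and not put into the multiplier: E is only C², while the energy identity needs
a C¹ multiplier. -/
theorem box_sub_multiplier (hy : y ∈ W) :
    2⁻¹ * g.box c (carlemanWeight ε h E) y - g.multiplier c h E ε μ y =
      (ε + h y + E y)⁻¹ * (μ + 2⁻¹ * g.box c E y) := by
  rw [hE.box_weight hε hε' hh hy, multiplier]
  ring

theorem hessForm_weight (hy : y ∈ W) (Y : Fin n → ℝ) :
    g.hessForm c (carlemanWeight ε h E) y Y Y =
      (ε + h y + E y)⁻¹ * (g.hessForm c h y Y Y + g.hessForm c E y Y Y) -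
        ((ε + h y + E y)⁻¹) ^ 2 *
          (∑ i, Y i * partialD i h y + ∑ i, Y i * partialD i E y) ^ 2 := by
  have h1 : (∑ i, Y i * partialD i h y + ∑ i, Y i * partialD i E y) ^ 2 =
      ∑ i, ∑ j, Y i * (partialD i h y + partialD i E y) *
        (Y j * (partialD j h y + partialD j E y)) := by
    rw [← Finset.sum_mul_sum, sq, ← Finset.sum_add_distrib]
    simp only [mul_add]
  rw [h1]
  simp only [hessForm, hE.hess_weight hε hε' hh hy]
  simp only [← Finset.sum_add_distrib, Finset.mul_sum, ← Finset.sum_sub_distrib]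
  exact Finset.sum_congr rfl fun i _ => Finset.sum_congr rfl fun j _ => by ring

end IsPerturbation

theorem abs_box_le (hΓ : 0 ≤ Γ) (hb : g.BoundedAt c Γ y)
    (hE : ∑ i, ∑ j, g.hess c E i j y ^ 2 ≤ ε ^ 4) : |g.box c E y| ≤ Γ * ε ^ 2 := by
  refine abs_le_of_sq_le_sq ?_ (by positivity)
  refine (sq_sum_sum_mul_le _ _).trans ?_
  calc _ ≤ Γ ^ 2 * ε ^ 4 := mul_le_mul hb.2 hE
        (Finset.sum_nonneg fun i _ => Finset.sum_nonneg fun j _ => sq_nonneg _) (sq_nonneg _)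
    _ = _ := by ring

/-- The strict null-convexity condition, multiplied by s = (ε+h+E)⁻¹, controls the form modulo the
square of Y(h), and the concavity of the logarithm pays for that square. -/
theorem IsPerturbation.coercive (hε : IsSmallScale K Γ ε) (hK : 0 < K) (hΓ : 0 < Γ)
    (hh : ContDiffOn ℝ 2 h W) (hE : g.IsPerturbation c h ε W E) (hb : g.BoundedAt c Γ y)
    (hconv : g.ConvexAt c h K μ y) (hy : y ∈ W) (Y : Fin n → ℝ) :
    2⁻¹ * K⁻¹ * (ε + h y + E y)⁻¹ * ∑ i, Y i ^ 2 +
        2⁻¹ * ((ε + h y + E y)⁻¹ *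
          (∑ i, Y i * partialD i h y + ∑ i, Y i * partialD i E y)) ^ 2 ≤
      -g.hessForm c (carlemanWeight ε h E) y Y Y +
        (2⁻¹ * g.box c (carlemanWeight ε h E) y - g.multiplier c h E ε μ y) *
          ∑ i, ∑ j, Y i * Y j * g.gram c y i j := by
  have hε0 := hε.pos
  have hε1 := hε.le_quarter
  have hN : 0 ≤ ∑ i, Y i ^ 2 := Finset.sum_nonneg fun i _ => sq_nonneg _
  have hs := hE.one_le_inv hε0 hε1 hy
  rw [hE.hessForm_weight hε0 hε1 hh hy, hE.box_sub_multiplier hε0 hε1 hh hy]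
  refine convexity_lower_bound ?_ hK hN ?_ ?_ ?_ ?_ hε.error_le
  · have h1 := mul_le_mul_of_nonneg_left hs (by positivity : 0 ≤ 4 * K)
    have h2 : 0 < (ε + h y + E y)⁻¹ := inv_pos.2 (hE.pos hε0 hε1 hy)
    nlinarith [mul_le_mul_of_nonneg_right hε.mul_le_one h2.le]
  · refine (hconv.2 Y).trans (le_of_eq ?_)
    congr 1
    simp only [hessForm, Finset.mul_sum]
    simp only [← Finset.sum_sub_distrib]
    exact Finset.sum_congr rfl fun i _ => Finset.sum_congr rfl fun j _ => by ring
  · refine (Finset.sum_mul_sq_le_sq_mul_sq _ _ _).trans ?_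
    rw [mul_comm]
    exact mul_le_mul_of_nonneg_right (hE.partialD_le y hy) hN
  · refine (le_abs_self _).trans (abs_quadratic_le (sq_nonneg ε) ?_ Y)
    rw [← pow_mul]
    exact hE.hess_le y hy
  · have h1 := abs_box_le hΓ.le hb (hE.hess_le y hy)
    have h2 := abs_quadratic_le hΓ.le hb.1 Y
    refine (abs_le.1 ?_).1
    rw [abs_mul]
    calc _ ≤ Γ * ε ^ 2 * (Γ * ∑ i, Y i ^ 2) :=
          mul_le_mul h1 h2 (abs_nonneg _) (by positivity)
      _ = _ := by ring

section Chart

variable (hc : c ∈ IsManifold.maximalAtlas 𝓘(ℝ, Coord n) ∞ M) [IsManifold 𝓘(ℝ, Coord n) ∞ M]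
include hc

theorem gram_quadratic_grad (hy : y ∈ c.target) (u : Coord n → ℝ) :
    ∑ i, ∑ j, g.grad c u i y * g.grad c u j y * g.gram c y i j = g.pairing c u u y := by
  simp only [pairing, ← gram_mul_grad (g := g) (u := u) hc hy, Finset.sum_mul]
  refine Finset.sum_congr rfl fun i _ => Finset.sum_congr rfl fun j _ => by ring

theorem sum_partialD_sq_le (hb : g.BoundedAt c Γ y) (hy : y ∈ c.target) (u : Coord n → ℝ) :
    ∑ i, partialD i u y ^ 2 ≤ Γ ^ 2 * ∑ i, g.grad c u i y ^ 2 := by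
  simp only [← gram_mul_grad (g := g) (u := u) hc hy]
  exact sum_sq_mulVec_le hb.1 _

/-- Coercivity is applied at ∇f, where g(Y,Y) equals ⟨df,df⟩. The sign of the second term differs
from the one in the coercive form, so twice that term has to be subtracted. -/
theorem IsPerturbation.transversal (hε : IsSmallScale K Γ ε) (hK : 0 < K) (hΓ : 0 < Γ)
    (hh : ContDiffOn ℝ 2 h W) (hE : g.IsPerturbation c h ε W E) (hb : g.BoundedAt c Γ y)
    (hμ : |μ| ≤ K) (hconv : g.ConvexAt c h K μ y) (hy : y ∈ W) (hyt : y ∈ c.target) :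
    1 ≤ -g.hessForm c (carlemanWeight ε h E) y (fun i => g.grad c (carlemanWeight ε h E) i y)
          (fun i => g.grad c (carlemanWeight ε h E) i y) -
        (2⁻¹ * g.box c (carlemanWeight ε h E) y - g.multiplier c h E ε μ y) *
          g.pairing c (carlemanWeight ε h E) (carlemanWeight ε h E) y := by
  have hε0 := hε.pos
  have hε1 := hε.le_quarter
  have hB := hE.coercive hε hK hΓ hh hb hconv hy
    (fun i => g.grad c (carlemanWeight ε h E) i y)
  rw [gram_quadratic_grad hc hyt] at hB
  have hbE := abs_box_le hΓ.le hb (hE.hess_le y hy)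
  -- The differential of h has length at least K⁻¹ and that of E at most ε² ≤ K⁻¹/2. Lowering the
  -- index with a bounded metric carries the lower bound over to the gradient.
  have hd : 4⁻¹ * (K⁻¹) ^ 2 ≤ Γ ^ 2 * ∑ i, (g.grad c h i y + g.grad c E i y) ^ 2 := by
    have h1 : (K⁻¹) ^ 2 ≤ ∑ i, partialD i h y ^ 2 := by
      have := pow_le_pow_left₀ (inv_nonneg.2 hK.le) hconv.1 2
      rwa [diffNorm, Real.sq_sqrt (Finset.sum_nonneg fun i _ => sq_nonneg _)] at this
    have h2 := sum_add_sq_le (fun i => partialD i h y + partialD i E y) (fun i => -partialD i E y)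
    simp only [add_neg_cancel_right, neg_sq] at h2
    have h3 := hE.partialD_le y hy
    have h4 : ∑ i, (partialD i h y + partialD i E y) ^ 2 ≤
        Γ ^ 2 * ∑ i, (g.grad c h i y + g.grad c E i y) ^ 2 := by
      simp only [← gram_mul_grad (g := g) hc hyt, ← Finset.sum_add_distrib, ← mul_add]
      exact sum_sq_mulVec_le hb.1 _
    have h5 := hε.pow_four_le
    linarith
  have key := transversal_lower_bound (b := g.box c E y) (μ := μ) hK hΓ
    (hE.one_le_inv hε0 hε1 hy) hε hB
    (G := g.pairing c (carlemanWeight ε h E) (carlemanWeight ε h E) y)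
    (p := ∑ i, (g.grad c h i y + g.grad c E i y) ^ 2) ?_ ?_ hd
    (hE.box_sub_multiplier (μ := μ) hε0 hε1 hh hy) hμ ?_
  · linarith
  · rw [hE.pairing_weight hε0 hε1 hh hy, ← Finset.sum_add_distrib]
    simp only [mul_add]
  · simp only [hE.grad_weight hε0 hε1 hh hy, mul_pow, Finset.mul_sum]
  · refine hbE.trans ?_
    exact mul_le_of_le_one_right hΓ.le (by nlinarith)

end Chart
end PseudoRiemannianMetric

/-! ### Bounds uniform in the neighbourhood and the perturbation -/

theorem Asymptotics.IsBigO.mul_one_one {ι : Type*} {l : Filter ι} {F G : ι → ℝ}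
    (hF : F =O[l] (fun _ => (1 : ℝ))) (hG : G =O[l] (fun _ => (1 : ℝ))) :
    (fun x => F x * G x) =O[l] (fun _ => (1 : ℝ)) := by
  simpa using hF.mul hG

theorem Asymptotics.IsBigO.fun_sum_one {ι κ : Type*} {l : Filter ι} {s : Finset κ}
    {F : κ → ι → ℝ} (hF : ∀ i ∈ s, F i =O[l] (fun _ => (1 : ℝ))) :
    (fun x => ∑ i ∈ s, F i x) =O[l] (fun _ => (1 : ℝ)) := by
  simpa only [← Finset.sum_apply] using Asymptotics.IsBigO.sum hF

theorem natCast_le_infty (k : ℕ) : (k : WithTop ℕ∞) ≤ ∞ := by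
  exact_mod_cast le_top

theorem IsCompact.isBigO_one_of_mapsTo {ι X : Type*} [TopologicalSpace X] {S : Set X}
    (hS : IsCompact S) {q : X → ℝ} (hq : ContinuousOn q S) {T : Set ι} {p : ι → X}
    (hp : Set.MapsTo p T S) : (fun x => q (p x)) =O[Filter.principal T] (fun _ => (1 : ℝ)) := by
  obtain ⟨C, hC⟩ := hS.exists_bound_of_continuousOn hq
  exact Asymptotics.IsBigO.of_bound C (Filter.eventually_principal.2 fun x hx => by
    simpa using hC _ (hp hx))

namespace PseudoRiemannianMetric

variable {n : ℕ} {M : Type*} [TopologicalSpace M] [ChartedSpace (Coord n) M]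
  {g : PseudoRiemannianMetric n M} {c : OpenPartialHomeomorph M (Coord n)}
  {h E : Coord n → ℝ} {W Ω S : Set (Coord n)} {y : Coord n} {K Γ ε μ : ℝ}

section Chart

variable (hc : c ∈ IsManifold.maximalAtlas 𝓘(ℝ, Coord n) ∞ M) [IsManifold 𝓘(ℝ, Coord n) ∞ M]
include hc

theorem IsPerturbation.contDiffOn_multiplier (hε : 0 < ε) (hε' : ε ≤ 1 / 4)
    (hWc : W ⊆ c.target) (hh : ContDiffOn ℝ ∞ h W) (hE : g.IsPerturbation c h ε W E) :
    ContDiffOn ℝ 1 (g.multiplier c h E ε μ) W := by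
  have hh2 : ContDiffOn ℝ 2 h W := hh.of_le (natCast_le_infty 2)
  have hf := hE.contDiffOn_weight hε hε' hh2
  have hbox : ContDiffOn ℝ 1 (g.box c h) W :=
    box_contDiffOn hc (by norm_num) (by norm_num; exact natCast_le_infty 3) hE.isOpen hWc hh
  exact contDiffOn_const.mul (((hbox.sub contDiffOn_const).mul
    (((hE.contDiffOn_argument hh2).of_le (by norm_num)).inv fun z hz =>
      (hE.pos hε hε' hz).ne')).sub
    (pairing_contDiffOn hc (by norm_num) (by norm_num) hE.isOpen hWc hf hf))

/-- The formula shows that third derivatives fall only on h. Derivatives of E occur up to order two,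
where the negligibility bounds apply. -/
theorem IsPerturbation.partialD_multiplier (hε : 0 < ε) (hε' : ε ≤ 1 / 4)
    (hWc : W ⊆ c.target) (hh : ContDiffOn ℝ ∞ h W) (hE : g.IsPerturbation c h ε W E)
    (hy : y ∈ W) (k : Fin n) :
    partialD k (g.multiplier c h E ε μ) y =
      2⁻¹ * (partialD k (g.box c h) y * (ε + h y + E y)⁻¹ + (g.box c h y - 2 * μ) *
        (-((ε + h y + E y)⁻¹ * (ε + h y + E y)⁻¹) * (partialD k h y + partialD k E y)) -
        ∑ i, (g.hess c (carlemanWeight ε h E) k i y * g.grad c (carlemanWeight ε h E) i y +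
          g.hess c (carlemanWeight ε h E) k i y * g.grad c (carlemanWeight ε h E) i y)) := by
  have hW := hE.isOpen
  have hh2 : ContDiffOn ℝ 2 h W := hh.of_le (natCast_le_infty 2)
  have hf := hE.contDiffOn_weight hε hε' hh2
  have hbox : DifferentiableAt ℝ (g.box c h) y :=
    (box_contDiffOn (k := 1) hc (by norm_num) (by norm_num; exact natCast_le_infty 3) hW hWc hh).differentiableAt_of_isOpen
      hW hy (by simp)
  have hbox' : DifferentiableAt ℝ (fun z => g.box c h z - 2 * μ) y := hbox.sub_const _
  have hpair : DifferentiableAt ℝ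
      (g.pairing c (carlemanWeight ε h E) (carlemanWeight ε h E)) y :=
    (pairing_contDiffOn (k := 1) hc (by norm_num) (by norm_num) hW hWc hf
      hf).differentiableAt_of_isOpen hW hy (by simp)
  have harg := (hE.contDiffOn_argument hh2).differentiableAt_of_isOpen hW hy (by simp)
  have hpos := (hE.pos hε hε' hy).ne'
  have hinv : DifferentiableAt ℝ (fun z => (ε + h z + E z)⁻¹) y := harg.inv hpos
  change partialD k (fun z => 2⁻¹ * ((g.box c h z - 2 * μ) * (ε + h z + E z)⁻¹ -
    g.pairing c (carlemanWeight ε h E) (carlemanWeight ε h E) z)) y = _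
  rw [partialD_const_mul
      (u := fun z => (g.box c h z - 2 * μ) * (ε + h z + E z)⁻¹ -
        g.pairing c (carlemanWeight ε h E) (carlemanWeight ε h E) z)
      ((hbox'.mul hinv).sub hpair),
    partialD_sub (u := fun z => (g.box c h z - 2 * μ) * (ε + h z + E z)⁻¹)
      (hbox'.mul hinv) hpair,
    partialD_mul hbox' hinv, partialD_sub (v := fun _ => 2 * μ) hbox (differentiableAt_const _),
    partialD_const,
    partialD_comp (F := fun t => t⁻¹) (u := fun z => ε + h z + E z) (hasDerivAt_inv hpos) harg,
    hE.partialD_argument hh2 hy, partialD_pairing hc hW hWc hf hf hy, ← mul_inv, ← sq, sub_zero]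

theorem exists_weight_bound (hΩ : IsOpen Ω) (hΩc : Ω ⊆ c.target) (hh : ContDiffOn ℝ ∞ h Ω)
    (hS : IsCompact S) (hSΩ : S ⊆ Ω) (hε : 0 < ε) (hε' : ε ≤ 1 / 4) (μ : ℝ) :
    ∃ D : ℝ, 0 < D ∧ ∀ W E, W ⊆ S → g.IsPerturbation c h ε W E → ∀ y ∈ W,
      g.box c (carlemanWeight ε h E) y ^ 2 ≤ D ∧ g.multiplier c h E ε μ y ^ 2 ≤ D ∧
      ∑ k, partialD k (g.multiplier c h E ε μ) y ^ 2 ≤ D ∧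
      ∑ k, partialD k (carlemanWeight ε h E) y ^ 2 ≤ D := by
  -- Being O(1) along the principal filter of these triples (neighbourhood, perturbation, point)
  -- means being bounded uniformly in all three, and this notion is stable under sums and products.
  let T : Set (Set (Coord n) × (Coord n → ℝ) × Coord n) :=
    {x | x.1 ⊆ S ∧ g.IsPerturbation c h ε x.1 x.2.1 ∧ x.2.2 ∈ x.1}
  let l := Filter.principal T
  have hmaps : Set.MapsTo (fun x : Set (Coord n) × (Coord n → ℝ) × Coord n => x.2.2) T S :=
    fun x hx => hx.1 hx.2.2
  have hxh : ∀ x ∈ T, ContDiffOn ℝ ∞ h x.1 := fun x hx => hh.mono (hx.1.trans hSΩ)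
  have hxh2 : ∀ x ∈ T, ContDiffOn ℝ 2 h x.1 := fun x hx => (hxh x hx).of_le (natCast_le_infty 2)
  have hxc : ∀ x ∈ T, x.1 ⊆ c.target := fun x hx => hx.1.trans (hSΩ.trans hΩc)
  have one : ∀ a : ℝ, (fun _ : Set (Coord n) × (Coord n → ℝ) × Coord n => a) =O[l]
      (fun _ => (1 : ℝ)) := fun a => Asymptotics.isBigO_const_const _ one_ne_zero _
  have hcont : ∀ q : Coord n → ℝ, ContinuousOn q Ω →
      (fun x : Set (Coord n) × (Coord n → ℝ) × Coord n => q x.2.2) =O[l] (fun _ => (1 : ℝ)) :=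
    fun q hq => hS.isBigO_one_of_mapsTo (hq.mono hSΩ) hmaps
  have bound : ∀ (F : Set (Coord n) × (Coord n → ℝ) × Coord n → ℝ) (r : ℝ),
      (∀ x ∈ T, |F x| ≤ r) → F =O[l] (fun _ => (1 : ℝ)) := fun F r hF =>
    Asymptotics.IsBigO.of_bound r (Filter.eventually_principal.2 fun x hx => by
      simpa using hF x hx)
  have b_inv : (fun x : Set (Coord n) × (Coord n → ℝ) × Coord n => (ε + h x.2.2 + x.2.1 x.2.2)⁻¹)
      =O[l] (fun _ => (1 : ℝ)) := by
    refine bound _ ((ε / 4)⁻¹) fun x hx => ?_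
    rw [abs_of_pos (inv_pos.2 (hx.2.1.pos hε hε' hx.2.2))]
    exact inv_anti₀ (by positivity) (hx.2.1.quarter_le hε hε' hx.2.2)
  have b_ginv : ∀ i j, (fun x : Set (Coord n) × (Coord n → ℝ) × Coord n =>
      (g.gram c x.2.2)⁻¹ i j) =O[l] (fun _ => (1 : ℝ)) := fun i j =>
    hcont (fun z => (g.gram c z)⁻¹ i j) (((gram_inv_contDiffOn hc i j).mono hΩc).continuousOn)
  have b_dh : ∀ i, (fun x : Set (Coord n) × (Coord n → ℝ) × Coord n =>
      partialD i h x.2.2) =O[l] (fun _ => (1 : ℝ)) := fun i =>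
    hcont _ (hh.partialD (k := 0) hΩ (by norm_num) i).continuousOn
  have b_Hh : ∀ i j, (fun x : Set (Coord n) × (Coord n → ℝ) × Coord n =>
      g.hess c h i j x.2.2) =O[l] (fun _ => (1 : ℝ)) := fun i j =>
    hcont _ (hess_contDiffOn (k := 0) hc (by norm_num) (by norm_num; exact natCast_le_infty 2) hΩ hΩc hh i j).continuousOn
  have b_box : (fun x : Set (Coord n) × (Coord n → ℝ) × Coord n =>
      g.box c h x.2.2) =O[l] (fun _ => (1 : ℝ)) :=
    hcont _ (box_contDiffOn (k := 0) hc (by norm_num) (by norm_num; exact natCast_le_infty 2) hΩ hΩc hh).continuousOn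
  have b_dbox : ∀ k, (fun x : Set (Coord n) × (Coord n → ℝ) × Coord n =>
      partialD k (g.box c h) x.2.2) =O[l] (fun _ => (1 : ℝ)) := fun k =>
    hcont _ ((box_contDiffOn (k := 1) hc (by norm_num) (by norm_num; exact natCast_le_infty 3) hΩ hΩc hh).partialD
      (k := 0) hΩ (by norm_num) k).continuousOn
  have b_dE : ∀ i, (fun x : Set (Coord n) × (Coord n → ℝ) × Coord n =>
      partialD i x.2.1 x.2.2) =O[l] (fun _ => (1 : ℝ)) := fun i =>
    bound _ (ε ^ 2) fun x hx => by
      refine abs_le_of_sq_le_sq ?_ (sq_nonneg ε)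
      refine (Finset.single_le_sum (f := fun i => partialD i x.2.1 x.2.2 ^ 2)
        (fun i _ => sq_nonneg _) (Finset.mem_univ i)).trans ?_
      rw [← pow_mul]
      exact hx.2.1.partialD_le _ hx.2.2
  have b_HE : ∀ i j, (fun x : Set (Coord n) × (Coord n → ℝ) × Coord n =>
      g.hess c x.2.1 i j x.2.2) =O[l] (fun _ => (1 : ℝ)) := fun i j =>
    bound _ (ε ^ 2) fun x hx => by
      refine abs_le_of_sq_le_sq ?_ (sq_nonneg ε)
      refine (Finset.single_le_sum (f := fun j => g.hess c x.2.1 i j x.2.2 ^ 2)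
        (fun i _ => sq_nonneg _) (Finset.mem_univ j)).trans ?_
      refine (Finset.single_le_sum (f := fun i => ∑ j, g.hess c x.2.1 i j x.2.2 ^ 2)
        (fun i _ => Finset.sum_nonneg fun j _ => sq_nonneg _) (Finset.mem_univ i)).trans ?_
      rw [← pow_mul]
      exact hx.2.1.hess_le _ hx.2.2
  have congr : ∀ {F G : Set (Coord n) × (Coord n → ℝ) × Coord n → ℝ},
      F =O[l] (fun _ => (1 : ℝ)) → (∀ x ∈ T, G x = F x) → G =O[l] (fun _ => (1 : ℝ)) :=
    fun hF hG => hF.congr' (Filter.eventually_principal.2 fun x hx => (hG x hx).symm)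
      Filter.EventuallyEq.rfl
  have b_df : ∀ i, (fun x : Set (Coord n) × (Coord n → ℝ) × Coord n =>
      partialD i (carlemanWeight ε h x.2.1) x.2.2) =O[l] (fun _ => (1 : ℝ)) := fun i =>
    congr (b_inv.mul_one_one ((b_dh i).add (b_dE i))) fun x hx =>
      hx.2.1.partialD_weight hε hε' (hxh2 x hx) hx.2.2 i
  have b_Hf : ∀ i j, (fun x : Set (Coord n) × (Coord n → ℝ) × Coord n =>
      g.hess c (carlemanWeight ε h x.2.1) i j x.2.2) =O[l] (fun _ => (1 : ℝ)) := fun i j =>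
    congr ((b_inv.mul_one_one ((b_Hh i j).add (b_HE i j))).sub
      ((b_inv.mul_one_one b_inv).mul_one_one (((b_dh i).add (b_dE i)).mul_one_one
        ((b_dh j).add (b_dE j))))) fun x hx => by
      rw [hx.2.1.hess_weight hε hε' (hxh2 x hx) hx.2.2 i j, sq]
  have b_gradf : ∀ i, (fun x : Set (Coord n) × (Coord n → ℝ) × Coord n =>
      g.grad c (carlemanWeight ε h x.2.1) i x.2.2) =O[l] (fun _ => (1 : ℝ)) := fun i =>
    Asymptotics.IsBigO.fun_sum_one fun j _ => (b_ginv i j).mul_one_one (b_df j)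
  have b_boxf : (fun x : Set (Coord n) × (Coord n → ℝ) × Coord n =>
      g.box c (carlemanWeight ε h x.2.1) x.2.2) =O[l] (fun _ => (1 : ℝ)) :=
    Asymptotics.IsBigO.fun_sum_one fun i _ => Asymptotics.IsBigO.fun_sum_one fun j _ =>
      (b_ginv i j).mul_one_one (b_Hf i j)
  have b_pair : (fun x : Set (Coord n) × (Coord n → ℝ) × Coord n =>
      g.pairing c (carlemanWeight ε h x.2.1) (carlemanWeight ε h x.2.1) x.2.2) =O[l]
      (fun _ => (1 : ℝ)) :=
    Asymptotics.IsBigO.fun_sum_one fun i _ => (b_df i).mul_one_one (b_gradf i)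
  have b_w : (fun x : Set (Coord n) × (Coord n → ℝ) × Coord n =>
      g.multiplier c h x.2.1 ε μ x.2.2) =O[l] (fun _ => (1 : ℝ)) :=
    (one 2⁻¹).mul_one_one (((b_box.sub (one (2 * μ))).mul_one_one b_inv).sub b_pair)
  have b_dw : ∀ k, (fun x : Set (Coord n) × (Coord n → ℝ) × Coord n =>
      partialD k (g.multiplier c h x.2.1 ε μ) x.2.2) =O[l] (fun _ => (1 : ℝ)) := fun k =>
    congr ((one 2⁻¹).mul_one_one ((((b_dbox k).mul_one_one b_inv).add
      ((b_box.sub (one (2 * μ))).mul_one_one ((b_inv.mul_one_one b_inv).neg_left.mul_one_one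
        ((b_dh k).add (b_dE k))))).sub (Asymptotics.IsBigO.fun_sum_one fun i _ =>
        ((b_Hf k i).mul_one_one (b_gradf i)).add ((b_Hf k i).mul_one_one (b_gradf i)))))
      fun x hx => hx.2.1.partialD_multiplier hc hε hε' (hxc x hx) (hxh x hx) hx.2.2 k
  have b_sq : ∀ {F : Set (Coord n) × (Coord n → ℝ) × Coord n → ℝ},
      F =O[l] (fun _ => (1 : ℝ)) → (fun x => F x ^ 2) =O[l] (fun _ => (1 : ℝ)) :=
    fun hF => by simpa only [sq] using hF.mul_one_one hF
  have get : ∀ {F : Set (Coord n) × (Coord n → ℝ) × Coord n → ℝ},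
      F =O[l] (fun _ => (1 : ℝ)) → ∃ D, ∀ x ∈ T, F x ≤ D := fun hF => by
    obtain ⟨D, hD⟩ := Asymptotics.isBigO_principal.1 hF
    exact ⟨D, fun x hx => (le_abs_self _).trans (by simpa using hD x hx)⟩
  obtain ⟨D₁, h₁⟩ := get (b_sq b_boxf)
  obtain ⟨D₂, h₂⟩ := get (b_sq b_w)
  obtain ⟨D₃, h₃⟩ := get (Asymptotics.IsBigO.fun_sum_one (s := Finset.univ) fun k _ => b_sq (b_dw k))
  obtain ⟨D₄, h₄⟩ := get (Asymptotics.IsBigO.fun_sum_one (s := Finset.univ) fun k _ => b_sq (b_df k))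
  refine ⟨|D₁| + |D₂| + |D₃| + |D₄| + 1, by positivity, fun W E hWS hE y hy => ?_⟩
  have hx : ((W, E, y) : Set (Coord n) × (Coord n → ℝ) × Coord n) ∈ T := ⟨hWS, hE, hy⟩
  have p₁ := le_abs_self D₁
  have p₂ := le_abs_self D₂
  have p₃ := le_abs_self D₃
  have p₄ := le_abs_self D₄
  have q₁ := abs_nonneg D₁
  have q₂ := abs_nonneg D₂
  have q₃ := abs_nonneg D₃
  have q₄ := abs_nonneg D₄
  refine ⟨(h₁ _ hx).trans ?_, (h₂ _ hx).trans ?_, (h₃ _ hx).trans ?_, (h₄ _ hx).trans ?_⟩ <;>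
    linarith

theorem exists_boundedAt (hS : IsCompact S) (hSc : S ⊆ c.target) :
    ∃ Γ : ℝ, 0 < Γ ∧ ∀ y ∈ S, g.BoundedAt c Γ y := by
  have h1 : ContinuousOn (fun y => ∑ i, ∑ j, g.gram c y i j ^ 2) S :=
    continuousOn_finsetSum _ fun i _ => continuousOn_finsetSum _ fun j _ =>
      ((gram_contDiffOn hc i j).continuousOn.mono hSc).pow 2
  have h2 : ContinuousOn (fun y => ∑ i, ∑ j, (g.gram c y)⁻¹ i j ^ 2) S :=
    continuousOn_finsetSum _ fun i _ => continuousOn_finsetSum _ fun j _ =>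
      ((gram_inv_contDiffOn hc i j).continuousOn.mono hSc).pow 2
  obtain ⟨C₁, hC₁⟩ := hS.exists_bound_of_continuousOn h1
  obtain ⟨C₂, hC₂⟩ := hS.exists_bound_of_continuousOn h2
  have hle : ∀ {x : ℝ}, x ≤ |C₁| + |C₂| → x ≤ (1 + |C₁| + |C₂|) ^ 2 := fun hx => by
    nlinarith [abs_nonneg C₁, abs_nonneg C₂]
  refine ⟨1 + |C₁| + |C₂|, by positivity, fun y hy => ⟨hle ?_, hle ?_⟩⟩
  · have := (le_abs_self _).trans ((hC₁ y hy).trans (le_abs_self _))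
    linarith [abs_nonneg C₂]
  · have := (le_abs_self _).trans ((hC₂ y hy).trans (le_abs_self _))
    linarith [abs_nonneg C₁]

end Chart
end PseudoRiemannianMetric

/-! ### The squared Carleman estimate -/

theorem MeasureTheory.integral_add_const_mul {α : Type*} [MeasurableSpace α]
    {ν : Measure α} {p q : α → ℝ} (hp : Integrable p ν) (hq : Integrable q ν) (r : ℝ) :
    ∫ x, (p x + r * q x) ∂ν = ∫ x, p x ∂ν + r * ∫ x, q x ∂ν := by
  rw [integral_add hp (hq.const_mul r), integral_const_mul]

/-- Absorption of lower order terms. The cross terms with P = ⟨df,dψ⟩ consume at most 3/2 of the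
2λP². The zeroth order errors total ½(7D + D/β)λψ², hence at most half of λ²ψ², and the term
ψ⟨dw,dψ⟩ takes half of βN. The remaining halves are the gain. -/
theorem carleman_pointwise_bound {lam T P w ψ q A N b dw β D Φ : ℝ} (hlam1 : 1 ≤ lam)
    (hlam : 7 * D + D / β ≤ lam) (hβ : 0 < β) (hD : 0 < D) (hΦ : T + lam * b * ψ = Φ)
    (hq : β * N ≤ q) (hA : 1 ≤ A) (hb : b ^ 2 ≤ D) (hw : w ^ 2 ≤ D) (hdw : dw ^ 2 ≤ D * N) :
    T * (P + w * ψ) - (2 * lam * P ^ 2 + q + lam ^ 2 * ψ ^ 2 * A + 2 * lam * w * ψ * P - ψ * dw) +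
      (2⁻¹ * β * N + 2⁻¹ * lam ^ 2 * ψ ^ 2) ≤ 2 * lam⁻¹ * Φ ^ 2 := by
  have hl : 0 < lam := by linarith
  have e1 : T * (P + w * ψ) ≤
      lam⁻¹ * T ^ 2 + 2⁻¹ * lam * P ^ 2 + 2⁻¹ * lam * (w ^ 2 * ψ ^ 2) := by
    have h1 : 0 ≤ 2⁻¹ * lam⁻¹ * (T - lam * P) ^ 2 := by positivity
    have h2 : 0 ≤ 2⁻¹ * lam⁻¹ * (T - lam * (w * ψ)) ^ 2 := by positivity
    have h3 : 2⁻¹ * lam⁻¹ * (T - lam * P) ^ 2 =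
        2⁻¹ * lam⁻¹ * T ^ 2 - T * P + 2⁻¹ * lam * P ^ 2 := by field_simp; ring
    have h4 : 2⁻¹ * lam⁻¹ * (T - lam * (w * ψ)) ^ 2 =
        2⁻¹ * lam⁻¹ * T ^ 2 - T * (w * ψ) + 2⁻¹ * lam * (w ^ 2 * ψ ^ 2) := by field_simp; ring
    linarith
  have e2 : lam⁻¹ * T ^ 2 ≤ 2 * lam⁻¹ * Φ ^ 2 + 2 * lam * (b ^ 2 * ψ ^ 2) := by
    have h1 : T ^ 2 ≤ 2 * Φ ^ 2 + 2 * (lam * b * ψ) ^ 2 := by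
      rw [← hΦ]; nlinarith [sq_nonneg (T + lam * b * ψ + lam * b * ψ)]
    calc lam⁻¹ * T ^ 2 ≤ lam⁻¹ * (2 * Φ ^ 2 + 2 * (lam * b * ψ) ^ 2) :=
          mul_le_mul_of_nonneg_left h1 (inv_nonneg.2 hl.le)
      _ = _ := by field_simp
  have e3 : -(2 * lam * w * ψ * P) ≤ lam * P ^ 2 + lam * (w ^ 2 * ψ ^ 2) := by
    nlinarith [mul_nonneg hl.le (sq_nonneg (P + w * ψ))]
  have e4 : ψ * dw ≤ 2⁻¹ * β * N + 2⁻¹ * (D / β) * ψ ^ 2 := by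
    have h1 : 0 ≤ 2⁻¹ * (β / D) * (dw - D / β * ψ) ^ 2 := by positivity
    have h2 : 2⁻¹ * (β / D) * (dw - D / β * ψ) ^ 2 =
        2⁻¹ * (β / D) * dw ^ 2 - ψ * dw + 2⁻¹ * (D / β) * ψ ^ 2 := by field_simp; ring
    have h3 : 2⁻¹ * (β / D) * dw ^ 2 ≤ 2⁻¹ * (β / D) * (D * N) :=
      mul_le_mul_of_nonneg_left hdw (by positivity)
    have h4 : 2⁻¹ * (β / D) * (D * N) = 2⁻¹ * β * N := by field_simp
    linarith
  have hψ := sq_nonneg ψ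
  have e5 : lam * (b ^ 2 * ψ ^ 2) ≤ lam * (D * ψ ^ 2) := by gcongr
  have e6 : lam * (w ^ 2 * ψ ^ 2) ≤ lam * (D * ψ ^ 2) := by gcongr
  have e7 : lam ^ 2 * ψ ^ 2 ≤ lam ^ 2 * ψ ^ 2 * A := le_mul_of_one_le_right (by positivity) hA
  have e8 : (7 * D + D / β) * (lam * ψ ^ 2) ≤ lam * (lam * ψ ^ 2) :=
    mul_le_mul_of_nonneg_right hlam (by positivity)
  have e9 : D / β * ψ ^ 2 ≤ D / β * (lam * ψ ^ 2) := by
    have : 0 < D / β := by positivity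
    nlinarith [mul_nonneg (mul_nonneg this.le (sub_nonneg.2 hlam1)) hψ]
  have e10 : 0 ≤ lam * P ^ 2 := by positivity
  nlinarith

namespace PseudoRiemannianMetric

variable {n : ℕ} {M : Type*} [TopologicalSpace M] [ChartedSpace (Coord n) M]
  {g : PseudoRiemannianMetric n M} {c : OpenPartialHomeomorph M (Coord n)}
  {h E φ u : Coord n → ℝ} {W Ω S : Set (Coord n)} {y : Coord n} {K Γ ε μ : ℝ}

theorem support_hess_subset (u : Coord n → ℝ) (i j : Fin n) :
    Function.support (g.hess c u i j) ⊆ tsupport u := fun y hy => by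
  by_contra hn
  refine hy ?_
  have h1 : ∀ k, partialD k u y = 0 := fun k =>
    Function.notMem_support.1 fun h2 => hn (support_partialD_subset u k h2)
  have h2 : partialD i (partialD j u) y = 0 := Function.notMem_support.1 fun h2 =>
    hn (tsupport_partialD_subset u j (support_partialD_subset _ i h2))
  simp [hess, h1, h2]

theorem support_box_subset (u : Coord n → ℝ) :
    Function.support (g.box c u) ⊆ tsupport u := fun y hy => by
  by_contra hn
  refine hy ?_
  have h1 : ∀ i j, g.hess c u i j y = 0 := fun i j =>
    Function.notMem_support.1 fun h2 => hn (support_hess_subset u i j h2)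
  simp [box, h1]

theorem sq_diffNorm (u : Coord n → ℝ) (y : Coord n) :
    diffNorm u y ^ 2 = ∑ i, partialD i u y ^ 2 :=
  Real.sq_sqrt (Finset.sum_nonneg fun _ _ => sq_nonneg _)

theorem support_diffNorm_subset (u : Coord n → ℝ) :
    Function.support (diffNorm u) ⊆ tsupport u := fun y hy => by
  by_contra hn
  refine hy ?_
  have h1 : ∀ k, partialD k u y = 0 := fun k =>
    Function.notMem_support.1 fun h2 => hn (support_partialD_subset u k h2)
  simp [diffNorm, h1]

theorem continuousOn_diffNorm (hW : IsOpen W) (hu : ContDiffOn ℝ 1 u W) :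
    ContinuousOn (diffNorm u) W :=
  (continuousOn_finsetSum _ fun i _ =>
    (hu.partialD (k := 0) hW (by norm_num) i).continuousOn.pow 2).sqrt

section Chart

variable (hc : c ∈ IsManifold.maximalAtlas 𝓘(ℝ, Coord n) ∞ M) [IsManifold 𝓘(ℝ, Coord n) ∞ M]
include hc

/-- A continuous function with compact support in `W`, times a continuous factor on `W`, is square
integrable. -/
theorem integrableOn_sq_mul_density (hW : IsOpen W) (hWc : W ⊆ c.target) {F G : Coord n → ℝ}
    (hF : ContinuousOn F W) (hG : ContinuousOn G W) (hφ : HasCompactSupport φ)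
    (hφW : tsupport φ ⊆ W) (hFφ : Function.support F ⊆ tsupport φ) :
    IntegrableOn (fun y => (G y * F y) ^ 2 * g.density c y) W := by
  have hden : ContinuousOn (g.density c) W := (density_contDiffOn hc).continuousOn.mono hWc
  have h := integrableOn_mul_of_tsupport_subset hW hF (((hG.pow 2).mul hF).mul hden)
    (hφ.mono' hFφ) ((closure_minimal hFφ isClosed_closure).trans hφW)
  refine h.congr_fun (fun y _ => ?_) hW.measurableSet
  simp only [Pi.pow_apply, Pi.mul_apply]
  ring

theorem exists_carleman_estimate (hΩ : IsOpen Ω) (hΩc : Ω ⊆ c.target) (hh : ContDiffOn ℝ ∞ h Ω)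
    (hS : IsCompact S) (hSΩ : S ⊆ Ω) (hK : 0 < K) (hμ : |μ| ≤ K) (hΓ : 0 < Γ)
    (hb : ∀ y ∈ S, g.BoundedAt c Γ y) (hconv : ∀ y ∈ S, g.ConvexAt c h K μ y)
    (hε : IsSmallScale K Γ ε) :
    ∃ C : ℝ, 0 < C ∧ ∃ lam₀ : ℝ, 0 < lam₀ ∧ ∀ W E, W ⊆ S → g.IsPerturbation c h ε W E →
      ∀ φ : Coord n → ℝ, ContDiffOn ℝ 2 φ W → HasCompactSupport φ → tsupport φ ⊆ W →
      ∀ lam : ℝ, lam₀ ≤ lam →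
        lam ^ 2 * (∫ y in W, (Real.exp (-lam * carlemanWeight ε h E y) * φ y) ^ 2 *
            g.density c y) +
          ∫ y in W, (Real.exp (-lam * carlemanWeight ε h E y) * diffNorm φ y) ^ 2 *
            g.density c y ≤
        C * lam⁻¹ * ∫ y in W, (Real.exp (-lam * carlemanWeight ε h E y) * g.box c φ y) ^ 2 *
            g.density c y := by
  obtain ⟨D, hD, hDb⟩ := exists_weight_bound (g := g) hc hΩ hΩc hh hS hSΩ hε.pos hε.le_quarter μ
  have hε0 := hε.pos
  have hε1 := hε.le_quarter
  -- This is the coercivity constant (2K)⁻¹s at the lower bound s = 1/(2ε).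
  set β : ℝ := 4⁻¹ * K⁻¹ * ε⁻¹ with hβdef
  have hβ : 0 < β := by positivity
  -- Returning from ψ to φ uses e^{-λf}∂φ = ∂ψ + λψ∂f: the first summand pays for 2|∂ψ|² ≤ 2Γ²|∇ψ|²,
  -- the second for λ²ψ² + 2Dλ²ψ².
  set C₁ : ℝ := 4 * Γ ^ 2 / β + 2 * (1 + 2 * D) with hC₁def
  have hC₁ : 0 < C₁ := by positivity
  refine ⟨2 * C₁, by positivity, max 1 (7 * D + D / β), by positivity, ?_⟩
  intro W E hWS hE φ hφ hφc hφW lam hlam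
  have hlam1 := (le_max_left _ _).trans hlam
  have hlam2 := (le_max_right _ _).trans hlam
  have hl : 0 < lam := by linarith
  have hW := hE.isOpen
  have hWΩ := hWS.trans hSΩ
  have hWc := hWΩ.trans hΩc
  have hhW := hh.mono hWΩ
  have hh2 : ContDiffOn ℝ 2 h W := hhW.of_le (natCast_le_infty 2)
  set f := carlemanWeight ε h E with hfdef
  have hf : ContDiffOn ℝ 2 f W := hE.contDiffOn_weight hε0 hε1 hh2
  have hexp : ContDiffOn ℝ 2 (fun z => Real.exp (-lam * f z)) W :=
    (contDiffOn_const.mul hf).exp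
  let ψ : Coord n → ℝ := fun z => Real.exp (-lam * f z) * φ z
  have hψ : ContDiffOn ℝ 2 ψ W := hexp.mul hφ
  have hψs : tsupport ψ ⊆ tsupport φ := tsupport_mul_subset_right
  have hw := hE.contDiffOn_multiplier (μ := μ) hc hε0 hε1 hWc hhW
  have hψc : HasCompactSupport ψ := hφc.mul_left
  have i1 := integrableOn_sq_mul_density (g := g) hc hW hWc hφ.continuousOn hexp.continuousOn
    hφc hφW (subset_tsupport φ)
  have i2 := integrableOn_sq_mul_density (g := g) hc hW hWc
    (continuousOn_diffNorm hW (hφ.of_le (by norm_num))) hexp.continuousOn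
    hφc hφW (support_diffNorm_subset φ)
  have i3 := integrableOn_sq_mul_density (g := g) hc hW hWc
    (box_contDiffOn (g := g) (k := 0) hc (by norm_num) (by norm_num) hW hWc hφ).continuousOn
    hexp.continuousOn hφc hφW (support_box_subset φ)
  -- From the energy identity only three facts are needed: its integrand is integrable, has integral
  -- zero, and obeys the pointwise bound.
  obtain ⟨N, hNi, hN0, hN⟩ : ∃ N : Coord n → ℝ,
      IntegrableOn (fun y => N y * g.density c y) W ∧
      ∫ y in W, N y * g.density c y = 0 ∧
      ∀ y ∈ W, N y + (2⁻¹ * β * (∑ i, g.grad c ψ i y ^ 2) + 2⁻¹ * lam ^ 2 * ψ y ^ 2) ≤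
        2 * lam⁻¹ * (Real.exp (-lam * f y) * g.box c φ y) ^ 2 := by
    refine ⟨_, (integral_multiplier_identity (g := g) hc hW hWc hf hψ hw hψc
      (hψs.trans hφW) lam).1, (integral_multiplier_identity (g := g) hc hW hWc hf hψ hw hψc
      (hψs.trans hφW) lam).2, fun y hy => ?_⟩
    obtain ⟨d1, d2, d3, -⟩ := hDb W E hWS hE y hy
    refine carleman_pointwise_bound hlam1 hlam2 hβ hD
      (box_exp_mul hW hf hφ hy lam fun _ => rfl) ?_
      (hE.transversal hc hε hK hΓ hh2 (hb y (hWS hy)) hμ (hconv y (hWS hy)) hy (hWc hy)) d1 d2 ?_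
    · have h1 := hE.coercive hε hK hΓ hh2 (hb y (hWS hy)) (hconv y (hWS hy)) hy
        (fun i => g.grad c ψ i y)
      rw [gram_quadratic_grad hc (hWc hy)] at h1
      refine le_trans ?_ ((le_add_of_nonneg_right (by positivity)).trans h1)
      refine mul_le_mul_of_nonneg_right ?_ (Finset.sum_nonneg fun _ _ => sq_nonneg _)
      have h2 := mul_le_mul_of_nonneg_left (hE.one_le_inv hε0 hε1 hy) hβ.le
      rw [mul_one] at h2
      refine h2.trans (le_of_eq ?_)
      rw [hβdef]
      field_simp
      ring
    · refine (Finset.sum_mul_sq_le_sq_mul_sq _ _ _).trans ?_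
      exact mul_le_mul_of_nonneg_right d3 (Finset.sum_nonneg fun _ _ => sq_nonneg _)
  have hpt : ∀ y ∈ W, N y * g.density c y + C₁⁻¹ *
      ((Real.exp (-lam * f y) * diffNorm φ y) ^ 2 * g.density c y +
        lam ^ 2 * ((Real.exp (-lam * f y) * φ y) ^ 2 * g.density c y)) ≤
      2 * lam⁻¹ * ((Real.exp (-lam * f y) * g.box c φ y) ^ 2 * g.density c y) := by
    intro y hy
    obtain ⟨-, -, -, d4⟩ := hDb W E hWS hE y hy
    have h1 := sum_partialD_sq_le hc (hb y (hWS hy)) (hWc hy) ψ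
    have h2 : (Real.exp (-lam * f y) * diffNorm φ y) ^ 2 ≤
        2 * ∑ i, partialD i ψ y ^ 2 + 2 * (lam ^ 2 * ψ y ^ 2 * D) := by
      have hp : ∀ i, Real.exp (-lam * f y) * partialD i φ y =
          partialD i ψ y + lam * ψ y * partialD i f y := fun i => by
        rw [partialD_exp_mul (hf.differentiableAt_of_isOpen hW hy (by simp))
          (hφ.differentiableAt_of_isOpen hW hy (by simp))]
        ring
      calc _ = ∑ i, (partialD i ψ y + lam * ψ y * partialD i f y) ^ 2 := by
            rw [mul_pow, sq_diffNorm, Finset.mul_sum]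
            exact Finset.sum_congr rfl fun i _ => by rw [← hp, mul_pow]
        _ ≤ _ := sum_add_sq_le _ _
        _ = 2 * ∑ i, partialD i ψ y ^ 2 +
            2 * (lam ^ 2 * ψ y ^ 2 * ∑ i, partialD i f y ^ 2) := by
            simp only [mul_pow, Finset.mul_sum]
        _ ≤ _ := by gcongr
    have h3 : lam ^ 2 * ψ y ^ 2 + (Real.exp (-lam * f y) * diffNorm φ y) ^ 2 ≤
        C₁ * (2⁻¹ * β * (∑ i, g.grad c ψ i y ^ 2) + 2⁻¹ * lam ^ 2 * ψ y ^ 2) := by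
      have hG : 0 ≤ ∑ i, g.grad c ψ i y ^ 2 := Finset.sum_nonneg fun _ _ => sq_nonneg _
      have hψ0 : 0 ≤ lam ^ 2 * ψ y ^ 2 := by positivity
      have h4 : C₁ * (2⁻¹ * β * (∑ i, g.grad c ψ i y ^ 2) + 2⁻¹ * lam ^ 2 * ψ y ^ 2) =
          2 * (Γ ^ 2 * ∑ i, g.grad c ψ i y ^ 2) + (1 + 2 * D) * (lam ^ 2 * ψ y ^ 2) +
          (β * (1 + 2 * D) * (∑ i, g.grad c ψ i y ^ 2) +
            2 * Γ ^ 2 / β * (lam ^ 2 * ψ y ^ 2)) := by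
        rw [hC₁def]
        field_simp
        ring
      have h5 : 0 ≤ β * (1 + 2 * D) * (∑ i, g.grad c ψ i y ^ 2) +
            2 * Γ ^ 2 / β * (lam ^ 2 * ψ y ^ 2) := by positivity
      linarith
    have h6 : C₁⁻¹ * (lam ^ 2 * ψ y ^ 2 + (Real.exp (-lam * f y) * diffNorm φ y) ^ 2) ≤
        2⁻¹ * β * (∑ i, g.grad c ψ i y ^ 2) + 2⁻¹ * lam ^ 2 * ψ y ^ 2 := by
      rw [inv_mul_le_iff₀ hC₁]
      exact h3
    have h7 := mul_le_mul_of_nonneg_right ((add_le_add_right h6 (N y)).trans (hN y hy))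
      (density_pos (g := g) hc (hWc hy)).le
    linarith
  have i12 : IntegrableOn (fun y => (Real.exp (-lam * f y) * diffNorm φ y) ^ 2 * g.density c y +
      lam ^ 2 * ((Real.exp (-lam * f y) * φ y) ^ 2 * g.density c y)) W :=
    i2.add (i1.const_mul (lam ^ 2))
  have hle := setIntegral_mono_on (f := fun y => N y * g.density c y + C₁⁻¹ *
      ((Real.exp (-lam * f y) * diffNorm φ y) ^ 2 * g.density c y +
        lam ^ 2 * ((Real.exp (-lam * f y) * φ y) ^ 2 * g.density c y)))
    (hNi.add (i12.const_mul C₁⁻¹)) (i3.const_mul (2 * lam⁻¹)) hW.measurableSet hpt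
  rw [integral_add_const_mul hNi i12, integral_add_const_mul i2 i1, hN0, integral_const_mul,
    zero_add, inv_mul_le_iff₀ hC₁] at hle
  linarith

end Chart
end PseudoRiemannianMetric

/-! ### From squared integrals to norms on the manifold -/

theorem carleman_sqrt_bound {lam C A B Φ : ℝ} (hlam : 0 < lam) (hC : 0 < C) (hA : 0 ≤ A)
    (hB : 0 ≤ B) (hle : lam ^ 2 * A + B ≤ C * lam⁻¹ * Φ) :
    lam * Real.sqrt A + Real.sqrt B ≤
      Real.sqrt (2 * C) * lam ^ (-(1 / 2) : ℝ) * Real.sqrt Φ := by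
  have h1 : lam ^ (-(1 / 2) : ℝ) = Real.sqrt (lam⁻¹) := by
    rw [Real.rpow_neg hlam.le, Real.sqrt_inv, Real.sqrt_eq_rpow]
  rw [h1, ← Real.sqrt_mul (by positivity), ← Real.sqrt_mul (by positivity)]
  refine Real.le_sqrt_of_sq_le ?_
  have h2 := Real.sq_sqrt hA
  have h3 := Real.sq_sqrt hB
  calc (lam * Real.sqrt A + Real.sqrt B) ^ 2 ≤
        2 * (lam ^ 2 * Real.sqrt A ^ 2) + 2 * Real.sqrt B ^ 2 := by
        nlinarith [sq_nonneg (lam * Real.sqrt A - Real.sqrt B)]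
    _ ≤ _ := by rw [h2, h3]; linarith

namespace PseudoRiemannianMetric

variable {n : ℕ} {M : Type*} [TopologicalSpace M] [ChartedSpace (Coord n) M]
  {g : PseudoRiemannianMetric n M} {c : OpenPartialHomeomorph M (Coord n)}
  {u v : Coord n → ℝ} {W : Set (Coord n)}

theorem box_congr {y : Coord n} (huv : u =ᶠ[nhds y] v) : g.box c u y = g.box c v y := by
  simp only [box, hess, fun i => huv.partialD_eq i, fun i j => (huv.partialD j).partialD_eq i]

theorem diffNorm_congr {y : Coord n} (huv : u =ᶠ[nhds y] v) : diffNorm u y = diffNorm v y := by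
  simp only [diffNorm, fun i => huv.partialD_eq i]

section Chart

variable (hc : c ∈ IsManifold.maximalAtlas 𝓘(ℝ, Coord n) ∞ M) [IsManifold 𝓘(ℝ, Coord n) ∞ M]
include hc

/-- The volume measure is carried by the chart image, so u may be arbitrary outside it. -/
theorem eLpNorm_chartVolume (hW : IsOpen W) (hWc : W ⊆ c.target) (huv : Set.EqOn u v c.target)
    (hv : ∀ y ∉ W, v y = 0) (hint : IntegrableOn (fun y => v y ^ 2 * g.density c y) W) :
    eLpNorm u 2 (g.chartVolume c) =
      ENNReal.ofReal (Real.sqrt (∫ y in W, v y ^ 2 * g.density c y)) := by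
  have hden : AEMeasurable (fun y => ENNReal.ofReal (Real.sqrt |(g.gram c y).det|))
      (volume.restrict c.target) :=
    ((density_contDiffOn (g := g) hc).continuousOn.aemeasurable
      c.open_target.measurableSet).ennreal_ofReal
  have h1 : ∫⁻ y, ‖u y‖ₑ ^ (2 : ℝ) ∂(g.chartVolume c) =
      ENNReal.ofReal (∫ y in W, v y ^ 2 * g.density c y) := by
    rw [chartVolume, lintegral_withDensity_eq_lintegral_mul_non_measurable₀ _ hden
      (Filter.Eventually.of_forall fun _ => ENNReal.ofReal_lt_top),
      ofReal_integral_eq_lintegral_ofReal hint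
        (Filter.Eventually.of_forall fun y =>
          mul_nonneg (sq_nonneg _) (Real.sqrt_nonneg _))]
    have h2 : Set.EqOn ((fun y => ENNReal.ofReal (Real.sqrt |(g.gram c y).det|)) *
        fun y => ‖u y‖ₑ ^ (2 : ℝ))
        (W.indicator fun y => ENNReal.ofReal (v y ^ 2 * g.density c y)) c.target := by
      intro y hy
      have h3 : ‖v y‖ₑ ^ (2 : ℝ) = ENNReal.ofReal (v y ^ 2) := by
        rw [Real.enorm_eq_ofReal_abs, ENNReal.ofReal_rpow_of_nonneg (abs_nonneg _) (by norm_num)]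
        norm_num
      by_cases hyW : y ∈ W
      · rw [Set.indicator_of_mem hyW, Pi.mul_apply, huv hy, h3, mul_comm,
          ENNReal.ofReal_mul (sq_nonneg _)]
        rfl
      · rw [Set.indicator_of_notMem hyW, Pi.mul_apply, huv hy, hv y hyW]
        simp
    rw [setLIntegral_congr_fun c.open_target.measurableSet h2,
      setLIntegral_indicator hW.measurableSet, Set.inter_eq_left.2 hWc]
  rw [eLpNorm_eq_lintegral_rpow_enorm_toReal (by norm_num) (by norm_num)]
  simp only [ENNReal.toReal_ofNat]
  have h4 : 0 ≤ ∫ y in W, v y ^ 2 * g.density c y :=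
    integral_nonneg fun y => mul_nonneg (sq_nonneg _) (Real.sqrt_nonneg _)
  rw [h1, ENNReal.ofReal_rpow_of_nonneg h4 (by norm_num), Real.sqrt_eq_rpow]

end Chart
end PseudoRiemannianMetric

theorem ContMDiffOn.contDiffOn_comp_chart_symm {n : ℕ} {M : Type*} [TopologicalSpace M]
    [ChartedSpace (Coord n) M] [IsManifold 𝓘(ℝ, Coord n) ∞ M]
    {c : OpenPartialHomeomorph M (Coord n)}
    (hc : c ∈ IsManifold.maximalAtlas 𝓘(ℝ, Coord n) ∞ M) {k : WithTop ℕ∞} (hk : k ≤ ∞)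
    {e : M → ℝ} {U : Set M} (he : ContMDiffOn 𝓘(ℝ, Coord n) 𝓘(ℝ) k e U) :
    ContDiffOn ℝ k (e ∘ c.symm) (c.target ∩ c.symm ⁻¹' U) := by
  rw [← contMDiffOn_iff_contDiffOn]
  exact he.comp (((contMDiffOn_symm_of_mem_maximalAtlas hc).of_le hk).mono Set.inter_subset_left)
    fun y hy => hy.2

theorem mainTheorem3 {n : ℕ} {M : Type*} [TopologicalSpace M] [ChartedSpace (Coord n) M]
    [IsManifold 𝓘(ℝ, Coord n) ∞ M] (g : PseudoRiemannianMetric n M)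
    (O : Set M) (p : M) (U₁ : Set M) (h : M → ℝ)
    (hdef : IsDefiningFunction (n := n) O p U₁ h)
    (c : OpenPartialHomeomorph M (Coord n))
    (hc : c ∈ IsManifold.maximalAtlas 𝓘(ℝ, Coord n) ∞ M) (hU₁ : U₁ ⊆ c.source)
    (K μ : ℝ) (hconv : g.StrictNullConvexOn c h U₁ K μ)
    (V : Set M) (hV : IsCompact V) (hVU₁ : V ⊆ U₁) :
    ∃ ε₀ : ℝ, 0 < ε₀ ∧ ∀ ε : ℝ, 0 < ε → ε < ε₀ →
      ∃ C : ℝ, 0 < C ∧ ∃ lam₀ : ℝ, 0 < lam₀ ∧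
        ∀ (U : Set M) (e : M → ℝ), IsOpen U → p ∈ U → U ⊆ V →
          (∀ x ∈ U, |h x| ≤ 2⁻¹ * ε) → g.IsNegligible c U ε e →
          ∀ φ : M → ℝ, ContMDiff 𝓘(ℝ, Coord n) 𝓘(ℝ) 2 φ → HasCompactSupport φ →
            tsupport φ ⊆ U →
            ∀ lam : ℝ, lam₀ ≤ lam →
              ENNReal.ofReal lam *
                  eLpNorm (fun y => Real.exp (-lam * carlemanWeight ε h e (c.symm y)) *
                    φ (c.symm y)) 2 (g.chartVolume c) +
                eLpNorm (fun y => Real.exp (-lam * carlemanWeight ε h e (c.symm y)) *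
                    diffNorm (φ ∘ c.symm) y) 2 (g.chartVolume c) ≤
              ENNReal.ofReal (C * lam ^ (-(1 / 2) : ℝ)) *
                eLpNorm (fun y => Real.exp (-lam * carlemanWeight ε h e (c.symm y)) *
                    g.box c (φ ∘ c.symm) y) 2 (g.chartVolume c) := by
  have hK := hconv.pos
  have hμ : |μ| ≤ K := abs_le.2 hconv.mem_Icc
  let H : Coord n → ℝ := h ∘ c.symm
  let Ω : Set (Coord n) := c.target ∩ c.symm ⁻¹' U₁
  have hΩ : IsOpen Ω := c.isOpen_inter_preimage_symm hdef.isOpen_nhd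
  have hΩc : Ω ⊆ c.target := Set.inter_subset_left
  have hH : ContDiffOn ℝ ∞ H Ω := hdef.smooth.contDiffOn_comp_chart_symm hc le_rfl
  have hVc : V ⊆ c.source := hVU₁.trans hU₁
  have hS : IsCompact (c '' V) := hV.image_of_continuousOn (c.continuousOn.mono hVc)
  have hSΩ : c '' V ⊆ Ω := by
    rintro _ ⟨x, hx, rfl⟩
    refine ⟨c.map_source (hVc hx), ?_⟩
    rw [Set.mem_preimage, c.left_inv (hVc hx)]
    exact hVU₁ hx
  obtain ⟨Γ, hΓ, hb⟩ := PseudoRiemannianMetric.exists_boundedAt (g := g) hc hS (hSΩ.trans hΩc)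
  have hcv : ∀ y ∈ c '' V, g.ConvexAt c H K μ y := by
    rintro _ ⟨x, hx, rfl⟩
    exact ⟨hconv.le_diffNorm x (hVU₁ hx), hconv.convex x (hVU₁ hx)⟩
  obtain ⟨ε₀, hε₀, hsmall⟩ := exists_isSmallScale hK Γ
  refine ⟨ε₀, hε₀, fun ε hε hεε₀ => ?_⟩
  have hsm := hsmall ε hε hεε₀
  obtain ⟨C, hC, lam₀, hlam₀, main⟩ := PseudoRiemannianMetric.exists_carleman_estimate hc hΩ hΩc
    hH hS hSΩ hK hμ hΓ hb hcv hsm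
  refine ⟨Real.sqrt (2 * C), by positivity, lam₀, hlam₀, ?_⟩
  intro U e hU _ hUV hhU he φ hφ hφc hφU lam hlam
  have hl : 0 < lam := hlam₀.trans_le hlam
  let E : Coord n → ℝ := e ∘ c.symm
  let W : Set (Coord n) := c.target ∩ c.symm ⁻¹' U
  have hW : IsOpen W := c.isOpen_inter_preimage_symm hU
  have hWc : W ⊆ c.target := Set.inter_subset_left
  have hWS : W ⊆ c '' V := fun y hy => ⟨c.symm y, hUV hy.2, c.right_inv hy.1⟩
  have hE : g.IsPerturbation c H ε W E := by
    refine ⟨hW, he.contMDiffOn.contDiffOn_comp_chart_symm hc (natCast_le_infty 2),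
      fun y hy => hhU _ hy.2, fun y hy => he.abs_le _ hy.2, fun y hy => ?_, fun y hy => ?_⟩
    · have := pow_le_pow_left₀ (Real.sqrt_nonneg _) (he.diffNorm_le _ hy.2) 2
      rw [c.right_inv hy.1, Real.sq_sqrt (Finset.sum_nonneg fun _ _ => sq_nonneg _),
        ← pow_mul] at this
      exact this
    · have := pow_le_pow_left₀ (Real.sqrt_nonneg _) (he.hessNorm_le _ hy.2) 2
      rw [c.right_inv hy.1, Real.sq_sqrt
        (Finset.sum_nonneg fun _ _ => Finset.sum_nonneg fun _ _ => sq_nonneg _), ← pow_mul] at this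
      exact this
  -- The inverse chart has no meaning off its target, so the test function is cut off there. This
  -- changes no norm and gives a function with compact support in W.
  let ψ : Coord n → ℝ := c.target.indicator (φ ∘ c.symm)
  have hψeq : Set.EqOn (φ ∘ c.symm) ψ c.target := fun y hy => (Set.indicator_of_mem hy _).symm
  have hψev : ∀ y ∈ c.target, φ ∘ c.symm =ᶠ[nhds y] ψ := fun y hy =>
    hψeq.eventuallyEq_of_mem (c.open_target.mem_nhds hy)
  have hcomp : IsCompact (c '' tsupport φ) :=
    hφc.image_of_continuousOn (c.continuousOn.mono ((hφU.trans hUV).trans hVc))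
  have hsupp : Function.support ψ ⊆ c '' tsupport φ := by
    intro y hy
    have hyt : y ∈ c.target := Set.mem_of_indicator_ne_zero hy
    rw [Function.mem_support, ← hψeq hyt] at hy
    exact ⟨c.symm y, subset_tsupport φ hy, c.right_inv hyt⟩
  have hψc : HasCompactSupport ψ := HasCompactSupport.of_support_subset_isCompact hcomp hsupp
  have hψW : tsupport ψ ⊆ W := by
    refine (closure_minimal hsupp hcomp.isClosed).trans ?_
    rintro _ ⟨x, hx, rfl⟩
    have hxs : x ∈ c.source := hVc (hUV (hφU hx))
    refine ⟨c.map_source hxs, ?_⟩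
    rw [Set.mem_preimage, c.left_inv hxs]
    exact hφU hx
  have hψ2 : ContDiffOn ℝ 2 ψ W :=
    (hφ.contMDiffOn.contDiffOn_comp_chart_symm hc (natCast_le_infty 2)).congr
      fun y hy => (hψeq hy.1).symm
  have hf := hE.contDiffOn_weight hε hsm.le_quarter
    ((hH.mono (hWS.trans hSΩ)).of_le (natCast_le_infty 2))
  have hexp : ContinuousOn (fun z => Real.exp (-lam * carlemanWeight ε H E z)) W :=
    (continuousOn_const.mul hf.continuousOn).rexp
  have norm_eq : ∀ {F F' : Coord n → ℝ}, ContinuousOn F' W → Function.support F' ⊆ tsupport ψ →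
      (∀ y ∈ c.target, F y = F' y) →
      eLpNorm (fun y => Real.exp (-lam * carlemanWeight ε h e (c.symm y)) * F y) 2
        (g.chartVolume c) = ENNReal.ofReal (Real.sqrt (∫ y in W,
          (Real.exp (-lam * carlemanWeight ε H E y) * F' y) ^ 2 * g.density c y)) := by
    intro F F' hF' hsF hFF'
    refine PseudoRiemannianMetric.eLpNorm_chartVolume hc hW hWc
      (v := fun y => Real.exp (-lam * carlemanWeight ε H E y) * F' y)
      (fun y hy => ?_) (fun y hy => ?_)
      (PseudoRiemannianMetric.integrableOn_sq_mul_density hc hW hWc hF' hexp hψc hψW hsF)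
    · simp only [hFF' y hy]
      rfl
    · have : F' y = 0 := Function.notMem_support.1 fun hn => hy (hψW (hsF hn))
      simp only [this, mul_zero]
  rw [norm_eq (F := fun y => φ (c.symm y)) (F' := ψ) hψ2.continuousOn (subset_tsupport ψ)
      (fun y hy => hψeq hy),
    norm_eq (F := diffNorm (φ ∘ c.symm)) (F' := diffNorm ψ)
      (PseudoRiemannianMetric.continuousOn_diffNorm hW (hψ2.of_le (by norm_num)))
      (PseudoRiemannianMetric.support_diffNorm_subset ψ)
      (fun y hy => PseudoRiemannianMetric.diffNorm_congr (hψev y hy)),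
    norm_eq (F := g.box c (φ ∘ c.symm)) (F' := g.box c ψ)
      (PseudoRiemannianMetric.box_contDiffOn (k := 0) hc (by norm_num) (by norm_num) hW hWc
        hψ2).continuousOn
      (PseudoRiemannianMetric.support_box_subset ψ)
      (fun y hy => PseudoRiemannianMetric.box_congr (hψev y hy)),
    ← ENNReal.ofReal_mul hl.le, ← ENNReal.ofReal_add (by positivity) (by positivity),
    ← ENNReal.ofReal_mul (by positivity)]
  refine ENNReal.ofReal_le_ofReal (carleman_sqrt_bound hl hC ?_ ?_
    (main W E hWS hE ψ hψ2 hψc hψW lam hlam)) <;>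
  exact integral_nonneg fun y => mul_nonneg (sq_nonneg _) (Real.sqrt_nonneg _)
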